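/- There is an absolute constant $C$ such that the following two statements hold. All graphs are finite, simple and undirected (not necessarily connected), with non-negative integer edge weights. An $\alpha$-spanner of a weighted graph $G$ is a subgraph $H$ with the inherited weights such that $d_H(u,v)\le\alpha\, d_G(u,v)$ for all nodes $u,v$, where $d$ denotes the weighted distance ($\infty$ if $u,v$ are not connected). Its size is its number of edges. (1) *Broadcast congested clique.* For all $c,d\in\mathbb{N}$ there is $b\in\mathbb{N}$ such that for all $n$ and all integers $k\ge 1$ there is a deterministic algorithm in the broadcast congested clique on $n$ nodes with messages of $b\lceil\log_2 n\rceil$ bits with the following property. For every $n$-node graph $G$ with edge weights at most $n^c$, and every assignment of distinct identifiers from $\{0,\dots,n^d-1\}$ to the nodes, after at most $C\,k\,n^{1/k}\log n$ rounds every node outputs one and the same complete weighted edge set of a $(2k-1)$-spanner of $G$ of size at most $C\,k\,n^{1+1/k}$. Here each node initially knows $n$, $k$, its own identifier, and the identifiers of its neighbours with the weights of its incident edges; in each synchronous round every node broadcasts one message, which all nodes receive together with the identifier of the sender; local computation is arbitrary. (2) *Multipass streaming.* For every $c\in\mathbb{N}$ there is $b\in\mathbb{N}$ such that for all $n$ and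 all integers $k\ge1$ there is a deterministic streaming algorithm whose memory consists of at most $C\,(k+\log n)\,n^{1+1/k}$ words of $b\lceil\log_2 n\rceil$ bits each and which, for every graph $G$ on the node set $\{0,\dots,n-1\}$ with edge weights at most $n^c$, and every stream that lists each weighted edge of $G$ exactly once, in arbitrary order, outputs after $k$ passes over the stream the weighted edge set of a $(2k-1)$-spanner of $G$ of size at most $C\,k\,n^{1+1/k}$. The algorithm knows $n$ and $k$; its memory is what it keeps from one stream item to the next, and the computation on each item is arbitrary. -/

import Mathlib

noncomputable section

namespace DistSpanner

/-! ## Weighted graphs and spanners -/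

/-- Weighted distance: the least total weight of a walk from `u` to `v`
(`⊤` if there is none). -/
def wdist {V : Type} (G : SimpleGraph V) (w : Sym2 V → ℕ) (u v : V) : ℕ∞ :=
  ⨅ p : G.Walk u v, (((p.edges.map w).sum : ℕ) : ℕ∞)

/-- `H` is an `α`-spanner of the weighted graph `(G, w)`: a subgraph, with the inherited weights,
in which distances exceed those of `G` by a factor of at most `α`. -/
def IsSpanner {V : Type} (α : ℕ) (G : SimpleGraph V) (w : Sym2 V → ℕ) (H : SimpleGraph V) : Prop :=
  H ≤ G ∧ ∀ u v : V, wdist H w u v ≤ (α : ℕ∞) * wdist G w u v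

/-! ## The broadcast congested clique -/

/-- What a node knows initially about the graph: its own identifier, and for each incident edge
the identifier of the other endpoint together with the weight of the edge. -/
structure LocalInput where
  ident : ℕ
  incident : Set (ℕ × ℕ)

/-- The local input of node `v`, when node `u` carries the identifier `ident u`. -/
def localInput {n : ℕ} (G : SimpleGraph (Fin n)) (w : Sym2 (Fin n) → ℕ) (ident : Fin n → ℕ)
    (v : Fin n) : LocalInput where
  ident := ident v
  incident := {x | ∃ u, G.Adj v u ∧ x = (ident u, w s(v, u))}

/-- A deterministic algorithm for the broadcast congested clique with messages of `β` bits, whose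
nodes compute a set of weighted edges (given by the identifiers of their endpoints). All nodes run
the same code. In every round each node broadcasts one message that depends on its state, and then
updates its state from the messages broadcast in that round, each of which arrives together with
the identifier of its sender. Local computation is arbitrary. -/
structure BCCAlgorithm (β : ℕ) where
  State : Type
  init : LocalInput → State
  send : State → (Fin β → Bool)
  receive : State → Set (ℕ × (Fin β → Bool)) → State
  output : State → Set (Sym2 ℕ × ℕ)

/-- The state of every node after `t` rounds. -/
def BCCAlgorithm.run {β : ℕ} (A : BCCAlgorithm β) {n : ℕ} (G : SimpleGraph (Fin n))
    (w : Sym2 (Fin n) → ℕ) (ident : Fin n → ℕ) : ℕ → Fin n → A.State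
  | 0, v => A.init (localInput G w ident v)
  | t + 1, v => A.receive (A.run G w ident t v)
      (Set.range fun u => (ident u, A.send (A.run G w ident t u)))

/-- The weighted edges of `(H, w)`, in terms of node identifiers. -/
def identEdges {n : ℕ} (H : SimpleGraph (Fin n)) (w : Sym2 (Fin n) → ℕ) (ident : Fin n → ℕ) :
    Set (Sym2 ℕ × ℕ) :=
  {x | ∃ e ∈ H.edgeSet, x = (e.map ident, w e)}

/-! ## Multipass streaming -/

/-- A memory of `S` words of `β` bits each. -/
abbrev Memory (S β : ℕ) : Type := Fin S → Fin β → Bool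

/-- A deterministic multipass streaming algorithm on graphs with vertex set `Fin n` whose memory
consists of `S` words of `β` bits: it updates its memory on each weighted edge of the stream and
at the end of each pass, and it computes a set of weighted edges from its final memory. -/
structure StreamingAlgorithm (n S β : ℕ) where
  init : Memory S β
  step : Memory S β → Sym2 (Fin n) × ℕ → Memory S β
  endPass : Memory S β → Memory S β
  output : Memory S β → Set (Sym2 (Fin n) × ℕ)

/-- The memory after `p` passes over the stream. -/
def StreamingAlgorithm.run {n S β : ℕ} (A : StreamingAlgorithm n S β)
    (stream : List (Sym2 (Fin n) × ℕ)) : ℕ → Memory S β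
  | 0 => A.init
  | p + 1 => A.endPass (stream.foldl A.step (A.run stream p))

/-- The weighted edges of `(H, w)`. -/
def weightedEdges {n : ℕ} (H : SimpleGraph (Fin n)) (w : Sym2 (Fin n) → ℕ) :
    Set (Sym2 (Fin n) × ℕ) :=
  {x | ∃ e ∈ H.edgeSet, x = (e, w e)}

/-- `stream` lists every weighted edge of `(G, w)` exactly once, in an arbitrary order. -/
def IsEdgeStream {n : ℕ} (G : SimpleGraph (Fin n)) (w : Sym2 (Fin n) → ℕ)
    (stream : List (Sym2 (Fin n) × ℕ)) : Prop :=
  stream.Nodup ∧ ∀ x, x ∈ stream ↔ x ∈ weightedEdges G w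

end DistSpanner

end

/-! The algorithm is a derandomised Baswana–Sen clustering with `k` phases and `s` about `n ^ (1 /
k)`. At the start every node is its own cluster. In a phase each clustered node lists its lightest
live edges to the `q` nearest clusters, where `q = O(s log n)`. A set `R` of the listed clusters is
sampled; every node adds its list up to and including the first edge to a sampled cluster and joins
that cluster, or becomes unclustered if there is none.

Sampling with probability `1 / (3 s)` does well in expectation, and `exists_sample` extracts one
outcome that keeps at most a fraction `1 / s` of the clusters, hits every list of length `q` and
adds at most `9 n s` edges. Such an `R` depends only on the lists, so all nodes that know the lists
make the same choice, without further communication.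

Stretch (`PhaseInvariant`): the radius of a node bounds every edge weight on its path of at most `t`
edges to its center, and live edges are at least as heavy as the radii of both ends. If an edge
stops being live, one of its ends has added an edge, no heavier, to the cluster of the other end;
the detour through the center has at most `2 t + 1 ≤ 2 k - 1` edges (`reach_of_not_live`). After `t`
phases at most `n / s ^ t` clusters occur in the lists, so in the last phase the sample is empty,
nobody stays clustered and every edge is spanned (`phases_spec`).

Both models simulate these phases. A list has at most `q` entries, so `q` broadcast rounds make all
lists known. The list of a growing edge set depends only on the previous list and the new edge
(`light_light_union`), so one pass with `q` words per node suffices. Liveness is read off the radii,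
so no deleted edges need to be stored. -/

namespace DistSpanner

open Set

/-! ## Lightest items of distinct clusters -/

section Light

variable {α κ : Type*} [LinearOrder α]

/-- The items of `J` that are least in their cluster and are preceded by items of fewer than `q`
clusters. -/
def light (cl : α → κ) (q : ℕ) (J : Set α) : Set α :=
  {a | a ∈ J ∧ (∀ b ∈ J, cl b = cl a → a ≤ b) ∧ (cl '' {b | b ∈ J ∧ b < a}).ncard < q}

variable {cl : α → κ} {q : ℕ} {J K N : Set α}

theorem light_subset : light cl q J ⊆ J := fun _ h => h.1

theorem light_injOn : InjOn cl (light cl q J) := fun _ ha _ hb h =>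
  le_antisymm (ha.2.1 _ hb.1 h.symm) (hb.2.1 _ ha.1 h)

theorem exists_least_of_cluster (hJ : J.Finite) {b : α} (hb : b ∈ J) :
    ∃ a ∈ J, cl a = cl b ∧ a ≤ b ∧ ∀ x ∈ J, cl x = cl a → a ≤ x := by
  obtain ⟨a, ⟨haJ, hab⟩, hmin⟩ := Set.exists_min_image {x | x ∈ J ∧ cl x = cl b} id
    (hJ.subset fun x hx => hx.1) ⟨b, hb, rfl⟩
  exact ⟨a, haJ, hab, hmin b ⟨hb, rfl⟩, fun x hx hxa => hmin x ⟨hx, hxa.trans hab⟩⟩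

theorem finite_image_lt (hJ : J.Finite) (a : α) : (cl '' {b | b ∈ J ∧ b < a}).Finite :=
  (hJ.subset fun _ h => h.1).image _

theorem ncard_image_lt_mono (hJ : J.Finite) (hKJ : K ⊆ J) {a b : α} (hab : a ≤ b) :
    (cl '' {x | x ∈ K ∧ x < a}).ncard ≤ (cl '' {x | x ∈ J ∧ x < b}).ncard :=
  ncard_le_ncard (image_mono fun _ hx => ⟨hKJ hx.1, hx.2.trans_le hab⟩) (finite_image_lt hJ b)

theorem exists_light_le (hJ : J.Finite) {a b : α} (ha : a ∈ light cl q J) (hb : b ∈ J)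
    (hba : b < a) : ∃ z ∈ light cl q J, cl z = cl b ∧ z ≤ b := by
  obtain ⟨z, hz, hzb, hle, hmin⟩ := exists_least_of_cluster (cl := cl) hJ hb
  exact ⟨z, ⟨hz, hmin, (ncard_image_lt_mono hJ subset_rfl (hle.trans hba.le)).trans_lt ha.2.2⟩,
    hzb, hle⟩

/-- A list that is not full misses no cluster: the least missing representative would be preceded
only by clusters already in the list, fewer than `q`, and would therefore belong to it. -/
theorem exists_light_of_ncard_lt (hJ : J.Finite) (hq : (light cl q J).ncard < q) {b : α}
    (hb : b ∈ J) : ∃ z ∈ light cl q J, cl z = cl b ∧ z ≤ b := by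
  have key : ∀ a ∈ J, (∀ x ∈ J, cl x = cl a → a ≤ x) → a ∈ light cl q J := by
    by_contra! hcon
    obtain ⟨a₀, h₀, h₀', h₀''⟩ := hcon
    obtain ⟨a, ⟨haJ, hrep, hal⟩, hmin⟩ := Set.exists_min_image
      {a | a ∈ J ∧ (∀ x ∈ J, cl x = cl a → a ≤ x) ∧ a ∉ light cl q J} id
      (hJ.subset fun x hx => hx.1) ⟨a₀, h₀, h₀', h₀''⟩
    refine hal ⟨haJ, hrep, lt_of_le_of_lt ?_ hq⟩
    refine (ncard_le_ncard (t := cl '' light cl q J) ?_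
      ((hJ.subset light_subset).image _)).trans (ncard_image_le (hJ.subset light_subset))
    rintro _ ⟨y, ⟨hy, hya⟩, rfl⟩
    obtain ⟨z, hz, hzy, hle, hz'⟩ := exists_least_of_cluster (cl := cl) hJ hy
    refine ⟨z, ?_, hzy⟩
    by_contra hzl
    exact absurd (hmin z ⟨hz, hz', hzl⟩) (not_le.2 (hle.trans_lt hya))
  obtain ⟨z, hz, hzb, hle, hz'⟩ := exists_least_of_cluster (cl := cl) hJ hb
  exact ⟨z, key z hz hz', hzb, hle⟩

/-- All other items precede the last one and lie in distinct clusters, so there are fewer than `q`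
of them. -/
theorem ncard_light_le (hJ : J.Finite) : (light cl q J).ncard ≤ q := by
  have hfin := hJ.subset (light_subset (cl := cl) (q := q))
  rcases (light cl q J).eq_empty_or_nonempty with h | h
  · simp [h]
  obtain ⟨a, ha, hmax⟩ := Set.exists_max_image _ id hfin h
  have h1 : (light cl q J \ {a}).ncard ≤ (cl '' {b | b ∈ J ∧ b < a}).ncard := by
    rw [← (light_injOn.mono sdiff_subset).ncard_image]
    exact ncard_le_ncard (image_mono fun x hx => ⟨hx.1.1, lt_of_le_of_ne (hmax x hx.1) hx.2⟩)
      (finite_image_lt hJ a)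
  have h2 := ncard_sdiff_singleton_add_one ha hfin
  have h3 := ha.2.2
  omega

/-- Shrinking `J` to `K` could only matter if some `a` in `light cl q K` lost a preceding cluster.
The least item of `J` before `a` in such a cluster is least in its cluster and preceded only by
clusters that `K` shows before `a`, fewer than `q`; so it lies in `light cl q J ⊆ K`, a
contradiction. -/
theorem light_eq_of_subset (hJ : J.Finite) (h1 : light cl q J ⊆ K) (h2 : K ⊆ J) :
    light cl q K = light cl q J := by
  apply Subset.antisymm
  · intro a ha
    have himg : cl '' {b | b ∈ J ∧ b < a} = cl '' {b | b ∈ K ∧ b < a} := by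
      refine Subset.antisymm ?_ (image_mono fun x (hx : x ∈ K ∧ x < a) => ⟨h2 hx.1, hx.2⟩)
      by_contra hcon
      obtain ⟨_, ⟨b₀, hb₀, rfl⟩, hb₀'⟩ := not_subset.1 hcon
      obtain ⟨b, ⟨hbJ, hba, hbK⟩, hmin⟩ := Set.exists_min_image
        {b | b ∈ J ∧ b < a ∧ cl b ∉ cl '' {b | b ∈ K ∧ b < a}} id
        (hJ.subset fun x hx => hx.1) ⟨b₀, hb₀.1, hb₀.2, hb₀'⟩
      have hlt : ∀ x ∈ J, x < b → cl x ∈ cl '' {b | b ∈ K ∧ b < a} := fun x hx hxb => by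
        by_contra hx'
        exact absurd (hmin x ⟨hx, hxb.trans hba, hx'⟩) (not_le.2 hxb)
      refine hbK ⟨b, ⟨h1 ⟨hbJ, fun x hx hxb => ?_, ?_⟩, hba⟩, rfl⟩
      · by_contra hlt'
        exact hbK (hxb ▸ hlt x hx (not_le.1 hlt'))
      · refine lt_of_le_of_lt (ncard_le_ncard ?_ (finite_image_lt (hJ.subset h2) a)) ha.2.2
        rintro _ ⟨x, hx, rfl⟩
        exact hlt x hx.1 hx.2
    refine ⟨h2 ha.1, fun b hb hba => ?_, himg ▸ ha.2.2⟩
    by_contra hlt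
    have hb' : cl b ∈ cl '' {b | b ∈ J ∧ b < a} := ⟨b, ⟨hb, not_le.1 hlt⟩, rfl⟩
    rw [himg] at hb'
    obtain ⟨x, ⟨hxK, hxa⟩, hxb⟩ := hb'
    exact absurd (ha.2.1 x hxK (hxb.trans hba)) (not_le.2 hxa)
  · intro a ha
    exact ⟨h1 ha, fun b hb => ha.2.1 b (h2 hb),
      (ncard_image_lt_mono hJ h2 le_rfl).trans_lt ha.2.2⟩

theorem light_light_union (hJ : J.Finite) (hN : N.Finite) :
    light cl q (light cl q J ∪ N) = light cl q (J ∪ N) := by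
  refine light_eq_of_subset (hJ.union hN) ?_ (union_subset_union_left _ light_subset)
  rintro a ⟨ha | ha, h1, h2⟩
  · exact .inl ⟨ha, fun b hb => h1 b (.inl hb),
      (ncard_image_lt_mono (hJ.union hN) subset_union_left le_rfl).trans_lt h2⟩
  · exact .inr ha

end Light

/-! ## Sampling clusters -/

section Sampling

/-- Under independent sampling with probability `p`, a set of `j` elements is missed with
probability `(1 - p) ^ j`. -/
theorem sum_powerset_disjoint {κ : Type*} [DecidableEq κ] (M D : Finset κ) (hD : D ⊆ M) (p : ℝ) :
    ∑ R ∈ M.powerset, p ^ R.card * (1 - p) ^ (M.card - R.card) * (if Disjoint D R then 1 else 0)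
      = (1 - p) ^ D.card := by
  have h : M.powerset.filter (fun R => Disjoint D R) = (M \ D).powerset := by
    ext R
    simp only [Finset.mem_filter, Finset.mem_powerset, Finset.subset_sdiff]
    exact and_congr_right fun _ => disjoint_comm
  simp only [mul_ite, mul_one, mul_zero]
  rw [← Finset.sum_filter, h]
  have hc := Finset.card_sdiff_add_card_eq_card hD
  have : ∀ R ∈ (M \ D).powerset, p ^ R.card * (1 - p) ^ (M.card - R.card)
      = (1 - p) ^ D.card * (p ^ R.card * (1 - p) ^ ((M \ D).card - R.card)) := by
    intro R hR
    have := Finset.card_le_card (Finset.mem_powerset.1 hR)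
    rw [show M.card - R.card = D.card + ((M \ D).card - R.card) by omega, pow_add]
    ring
  rw [Finset.sum_congr rfl this, ← Finset.mul_sum, Finset.sum_pow_mul_eq_add_pow]
  simp

/-- The exponents are the ranks of the elements of `s`, which run through `0, …, s.card - 1`. -/
theorem sum_pow_card_lt {α : Type*} [LinearOrder α] (s : Finset α) (x : ℝ) :
    ∑ a ∈ s, x ^ (s.filter (· < a)).card = ∑ j ∈ Finset.range s.card, x ^ j := by
  induction s using Finset.induction_on_max with
  | empty => simp
  | insert m s hm ih =>
    have hms : m ∉ s := fun h => lt_irrefl _ (hm m h)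
    rw [Finset.sum_insert hms, Finset.card_insert_of_notMem hms, Finset.sum_range_succ, add_comm,
      ← ih]
    congr 1
    · refine Finset.sum_congr rfl fun a ha => ?_
      rw [Finset.filter_insert, if_neg (not_lt.2 (hm a ha).le)]
    · rw [Finset.filter_insert, if_neg (lt_irrefl _), Finset.filter_true_of_mem hm]

theorem sum_range_pow_le_inv {p : ℝ} (h0 : 0 < p) (h1 : p ≤ 1) (N : ℕ) :
    ∑ j ∈ Finset.range N, (1 - p) ^ j ≤ p⁻¹ := by
  rw [geom_sum_eq (by linarith)]
  rw [← neg_div_neg_eq, inv_eq_one_div, neg_sub, neg_sub, sub_sub_cancel]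
  have : 0 ≤ (1 - p) ^ N := pow_nonneg (by linarith) _
  gcongr
  linarith

/-- There is a sample of the clusters that is small, hits all long lists, and has small total
length of the list prefixes before the first sampled cluster. -/
theorem exists_sample {V α κ : Type*} [LinearOrder α] [DecidableEq κ] (X : Finset V) (n s q : ℕ)
    (hX : X.card ≤ n) (hn : 0 < n) (hs : 0 < s)
    (hq : (n : ℝ) * (1 - 1 / (3 * s)) ^ q < 1 / 3)
    (cl : α → κ) (B : V → Finset α) (M : Finset κ) (hM : 0 < M.card)
    (hinj : ∀ v ∈ X, InjOn cl (B v)) (hsub : ∀ v ∈ X, ∀ a ∈ B v, cl a ∈ M) :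
    ∃ R ⊆ M, R.card * s ≤ M.card ∧ (∀ v ∈ X, q ≤ (B v).card → ∃ a ∈ B v, cl a ∈ R) ∧
      ∑ v ∈ X, ((B v).filter fun a => ∀ b ∈ B v, b < a → cl b ∉ R).card ≤ 9 * n * s := by
  classical
  set p : ℝ := 1 / (3 * s) with hp
  have hsR : (1 : ℝ) ≤ s := by exact_mod_cast hs
  have hnR : (1 : ℝ) ≤ n := by exact_mod_cast hn
  have hMR : (0 : ℝ) < M.card := by exact_mod_cast hM
  have hXR : (X.card : ℝ) ≤ n := by exact_mod_cast hX
  have hp0 : 0 < p := by positivity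
  have hp1 : p ≤ 1 := by
    rw [hp, div_le_one (by positivity)]; linarith
  let wt : Finset κ → ℝ := fun R => p ^ R.card * (1 - p) ^ (M.card - R.card)
  have hwt : ∀ R, 0 ≤ wt R := fun R =>
    mul_nonneg (pow_nonneg hp0.le _) (pow_nonneg (by linarith) _)
  have hwt1 : ∑ R ∈ M.powerset, wt R = 1 := by
    simp only [wt]
    rw [Finset.sum_pow_mul_eq_add_pow]; simp
  -- The indicator that `R` misses `D`. Size, cost and number of missed lists are all sums of such
  -- terms, so `hind` evaluates or bounds each expectation.
  let ind : Finset κ → Finset κ → ℝ := fun D R => if Disjoint D R then 1 else 0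
  have hind : ∀ D ⊆ M, ∑ R ∈ M.powerset, wt R * ind D R = (1 - p) ^ D.card :=
    fun D hD => sum_powerset_disjoint M D hD p
  let pre : V → α → Finset κ := fun v a => ((B v).filter (· < a)).image cl
  have hpre : ∀ v ∈ X, ∀ a, pre v a ⊆ M := fun v hv a c hc => by
    obtain ⟨b, hb, rfl⟩ := Finset.mem_image.1 hc
    exact hsub v hv b (Finset.mem_filter.1 hb).1
  have himg : ∀ v ∈ X, (B v).image cl ⊆ M := fun v hv c hc => by
    obtain ⟨b, hb, rfl⟩ := Finset.mem_image.1 hc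
    exact hsub v hv b hb
  let cost : Finset κ → ℝ := fun R => ∑ v ∈ X, ∑ a ∈ B v, ind (pre v a) R
  let size : Finset κ → ℝ := fun R => ∑ c ∈ M, (1 - ind {c} R)
  let L := X.filter fun v => q ≤ (B v).card
  let miss : Finset κ → ℝ := fun R => ∑ v ∈ L, ind ((B v).image cl) R
  have hEcost : ∑ R ∈ M.powerset, wt R * cost R ≤ 3 * n * s := by
    have : ∑ R ∈ M.powerset, wt R * cost R
        = ∑ v ∈ X, ∑ a ∈ B v, ∑ R ∈ M.powerset, wt R * ind (pre v a) R := by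
      simp only [cost, Finset.mul_sum]
      rw [Finset.sum_comm]
      exact Finset.sum_congr rfl fun v _ => Finset.sum_comm
    rw [this]
    -- The clusters in a list are distinct, so the item of rank `j` is kept with probability `(1 -
    -- p) ^ j`, and the geometric series is at most `1 / p = 3 s`.
    have h1 : ∀ v ∈ X, ∑ a ∈ B v, ∑ R ∈ M.powerset, wt R * ind (pre v a) R ≤ 3 * s := by
      intro v hv
      have : ∀ a ∈ B v, ∑ R ∈ M.powerset, wt R * ind (pre v a) R
          = (1 - p) ^ ((B v).filter (· < a)).card := by
        intro a _
        rw [hind _ (hpre v hv a), Finset.card_image_of_injOn]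
        exact (hinj v hv).mono (Finset.coe_subset.2 (Finset.filter_subset _ _))
      rw [Finset.sum_congr rfl this, sum_pow_card_lt]
      refine (sum_range_pow_le_inv hp0 hp1 _).trans (le_of_eq ?_)
      rw [hp, one_div, inv_inv]
    calc _ ≤ X.card • (3 * s : ℝ) := Finset.sum_le_card_nsmul _ _ _ h1
      _ = X.card * (3 * s : ℝ) := by simp
      _ ≤ n * (3 * s) := by gcongr
      _ = _ := by ring
  have hEsize : ∑ R ∈ M.powerset, wt R * size R = M.card * p := by
    have : ∑ R ∈ M.powerset, wt R * size R
        = ∑ c ∈ M, (∑ R ∈ M.powerset, wt R - ∑ R ∈ M.powerset, wt R * ind {c} R) := by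
      simp only [size, Finset.mul_sum, mul_sub, mul_one, Finset.sum_sub_distrib]
      congr 1 <;> exact Finset.sum_comm
    rw [this, Finset.sum_congr rfl (g := fun _ => p), Finset.sum_const, nsmul_eq_mul]
    intro c hc
    rw [hwt1, hind _ (by simpa using hc)]
    simp
  have hEmiss : ∑ R ∈ M.powerset, wt R * miss R ≤ n * (1 - p) ^ q := by
    have : ∑ R ∈ M.powerset, wt R * miss R
        = ∑ v ∈ L, ∑ R ∈ M.powerset, wt R * ind ((B v).image cl) R := by
      simp only [miss, Finset.mul_sum]
      exact Finset.sum_comm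
    rw [this]
    have h1 : ∀ v ∈ L, ∑ R ∈ M.powerset, wt R * ind ((B v).image cl) R ≤ (1 - p) ^ q := by
      intro v hv
      obtain ⟨hv, hqv⟩ := Finset.mem_filter.1 hv
      rw [hind _ (himg v hv), Finset.card_image_of_injOn (hinj v hv)]
      exact pow_le_pow_of_le_one (by linarith) (by linarith) hqv
    have hLR : (L.card : ℝ) ≤ n :=
      le_trans (by exact_mod_cast Finset.card_le_card (Finset.filter_subset _ _)) hXR
    calc _ ≤ L.card • ((1 - p) ^ q) := Finset.sum_le_card_nsmul _ _ _ h1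
      _ = L.card * ((1 - p) ^ q) := by simp
      _ ≤ _ := mul_le_mul_of_nonneg_right hLR (pow_nonneg (by linarith) _)
  -- The scaling gives each term expectation at most `1 / 3`, strictly less for `miss`. If `Φ R <
  -- 1`, every term is below `1`, so no long list is missed.
  let Φ : Finset κ → ℝ := fun R => size R * (s / M.card) + cost R * (1 / (9 * n * s)) + miss R
  have hE : ∑ R ∈ M.powerset, wt R * Φ R < 1 := by
    have : ∑ R ∈ M.powerset, wt R * Φ R = (∑ R ∈ M.powerset, wt R * size R) * (s / M.card)
        + (∑ R ∈ M.powerset, wt R * cost R) * (1 / (9 * n * s))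
        + ∑ R ∈ M.powerset, wt R * miss R := by
      simp only [Φ, Finset.sum_mul, ← Finset.sum_add_distrib]
      exact Finset.sum_congr rfl fun R _ => by ring
    rw [this, hEsize]
    have e1 : M.card * p * (s / M.card) = 1 / 3 := by
      rw [hp]; field_simp
    have e2 : (∑ R ∈ M.powerset, wt R * cost R) * (1 / (9 * n * s)) ≤ 1 / 3 := by
      calc _ ≤ (3 * n * s : ℝ) * (1 / (9 * n * s)) := by gcongr
        _ = 1 / 3 := by field_simp; norm_num
    linarith
  obtain ⟨R, hR, hΦ⟩ : ∃ R ∈ M.powerset, Φ R < 1 := by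
    by_contra! hcon
    have : ∑ R ∈ M.powerset, wt R ≤ ∑ R ∈ M.powerset, wt R * Φ R :=
      Finset.sum_le_sum fun R hR => le_mul_of_one_le_right (hwt R) (hcon R hR)
    linarith
  have hRM := Finset.mem_powerset.1 hR
  have hind0 : ∀ D R, 0 ≤ ind D R := fun D R => by simp only [ind]; split_ifs <;> norm_num
  have hcost0 : 0 ≤ cost R := Finset.sum_nonneg fun _ _ => Finset.sum_nonneg fun _ _ => hind0 _ _
  have hmiss0 : 0 ≤ miss R := Finset.sum_nonneg fun _ _ => hind0 _ _
  have hsize : size R = R.card := by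
    have : ∀ c ∈ M, 1 - ind {c} R = if c ∈ R then 1 else 0 := by
      intro c _
      simp only [ind, Finset.disjoint_singleton_left]
      split_ifs <;> simp_all
    simp only [size]
    rw [Finset.sum_congr rfl this, Finset.sum_boole, Finset.filter_mem_eq_inter,
      Finset.inter_eq_right.2 hRM]
  have hcost : cost R
      = (∑ v ∈ X, ((B v).filter fun a => ∀ b ∈ B v, b < a → cl b ∉ R).card : ℕ) := by
    push_cast
    refine Finset.sum_congr rfl fun v _ => ?_
    rw [← Finset.sum_boole]
    refine Finset.sum_congr rfl fun a _ => ?_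
    simp only [ind, pre]
    congr 1
    simp only [Finset.disjoint_left, Finset.mem_image, Finset.mem_filter, eq_iff_iff]
    constructor
    · exact fun h b hb hba => h ⟨b, ⟨hb, hba⟩, rfl⟩
    · rintro h _ ⟨b, ⟨hb, hba⟩, rfl⟩
      exact h b hb hba
  have ht1 : 0 ≤ size R * (s / M.card) := by rw [hsize]; positivity
  have ht2 : 0 ≤ cost R * (1 / (9 * n * s)) := by positivity
  refine ⟨R, hRM, ?_, ?_, ?_⟩
  · have : (R.card : ℝ) * (s / M.card) ≤ 1 := by rw [← hsize]; linarith
    rw [← mul_div_assoc, div_le_one hMR] at this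
    exact_mod_cast this
  · intro v hv hqv
    by_contra! hcon
    have h1 : ind ((B v).image cl) R = 1 := by
      simp only [ind]
      rw [if_pos]
      rw [Finset.disjoint_left]
      rintro _ hc
      obtain ⟨b, hb, rfl⟩ := Finset.mem_image.1 hc
      exact hcon b hb
    have : ind ((B v).image cl) R ≤ miss R :=
      Finset.single_le_sum (f := fun v => ind ((B v).image cl) R) (fun _ _ => hind0 _ _)
        (Finset.mem_filter.2 ⟨hv, hqv⟩)
    linarith
  · have : cost R * (1 / (9 * n * s)) ≤ 1 := by linarith
    rw [mul_one_div, div_le_one (by positivity), hcost] at this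
    exact_mod_cast this

end Sampling

/-! ## One phase of the clustering -/

section Phase

variable {V : Type}

/-- For every clustered node, the center of its cluster and a bound on the weights of a path in the
spanner to that center. -/
abbrev Clustering (V : Type) : Type := V → Option (V × ℕ)

/-- The center of the cluster of the endpoint of an incident edge, given as `(weight, endpoint)`. -/
def itemCenter (f : Clustering V) (a : ℕ ×ₗ V) : Option V := (f (ofLex a).2).map Prod.fst

/-- The incident edges of `v` that join clustered nodes and are not lighter than their radii. -/
def live (f : Clustering V) (v : V) (I : Set (ℕ ×ₗ V)) : Set (ℕ ×ₗ V) :=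
  {a | a ∈ I ∧ (∃ x, f v = some x ∧ x.2 ≤ (ofLex a).1) ∧
    ∃ y, f (ofLex a).2 = some y ∧ y.2 ≤ (ofLex a).1}

/-- The edges of `E` at `v`. -/
def incidentItems (E : Set (Sym2 V × ℕ)) (v : V) : Set (ℕ ×ₗ V) :=
  {a | (s(v, (ofLex a).2), (ofLex a).1) ∈ E}

theorem live_union (f : Clustering V) (v : V) (I J : Set (ℕ ×ₗ V)) :
    live f v (I ∪ J) = live f v I ∪ live f v J := by
  ext a
  exact or_and_right

theorem live_subset (f : Clustering V) (v : V) (I : Set (ℕ ×ₗ V)) : live f v I ⊆ I :=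
  fun _ h => h.1

theorem incidentItems_finite {E : Set (Sym2 V × ℕ)} (hE : E.Finite) (v : V) :
    (incidentItems E v).Finite := by
  refine hE.preimage (f := fun a : ℕ ×ₗ V => (s(v, (ofLex a).2), (ofLex a).1)) ?_
  intro a _ b _ h
  simp only [Prod.mk.injEq, Sym2.congr_right] at h
  exact ofLex.injective (Prod.ext h.2 h.1)

variable [LinearOrder V]

/-- The lightest live edges from `v` to each of the `q` nearest clusters. -/
def candidates (f : Clustering V) (q : ℕ) (v : V) (I : Set (ℕ ×ₗ V)) : Set (ℕ ×ₗ V) :=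
  light (itemCenter f) q (live f v I)

/-- The clusters that occur in the lists `B`. -/
def centers (f : Clustering V) (B : V → Set (ℕ ×ₗ V)) : Set (Option V) :=
  {c | ∃ v, ∃ a ∈ B v, itemCenter f a = c}

/-- The part of the list of `v` up to the first edge to a cluster in `R`. -/
def chosen (f : Clustering V) (B : V → Set (ℕ ×ₗ V)) (R : Set (Option V)) (v : V) :
    Set (ℕ ×ₗ V) :=
  {a | a ∈ B v ∧ ∀ b ∈ B v, b < a → itemCenter f b ∉ R}

/-- The edges that all nodes add to the spanner. -/
def addedEdges (f : Clustering V) (B : V → Set (ℕ ×ₗ V)) (R : Set (Option V)) :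
    Set (Sym2 V × ℕ) :=
  {e | ∃ v, ∃ a ∈ chosen f B R v, e = (s(v, (ofLex a).2), (ofLex a).1)}

/-- The requirements on a set `R` of sampled clusters. -/
structure GoodSample (n s q : ℕ) (f : Clustering V) (B : V → Set (ℕ ×ₗ V))
    (R : Set (Option V)) : Prop where
  subset : R ⊆ centers f B
  card_le : R.ncard * s ≤ (centers f B).ncard
  empty : (centers f B).ncard ≤ s → R = ∅
  hit : ∀ v, q ≤ (B v).ncard → ∃ a ∈ B v, itemCenter f a ∈ R
  added : (addedEdges f B R).ncard ≤ 9 * n * s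

open Classical in
/-- The sampled clusters, a function of what is known to all nodes. -/
noncomputable def sample (n s q : ℕ) (f : Clustering V) (B : V → Set (ℕ ×ₗ V)) : Set (Option V) :=
  if h : ∃ R, GoodSample n s q f B R then h.choose else ∅

open Classical in
/-- A node joins the nearest sampled cluster in its list, if there is one. -/
noncomputable def nextClustering (f : Clustering V) (B : V → Set (ℕ ×ₗ V)) (R : Set (Option V)) :
    Clustering V := fun v =>
  if h : ∃ a ∈ chosen f B R v, itemCenter f a ∈ R then
    (itemCenter f h.choose).map fun c => (c, (ofLex h.choose).1)
  else none

/-- A phase of the algorithm: clustering and spanner are updated from the lists of all nodes. -/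
noncomputable def phase (n s q : ℕ) (S : Clustering V × Set (Sym2 V × ℕ)) (B : V → Set (ℕ ×ₗ V)) :
    Clustering V × Set (Sym2 V × ℕ) :=
  (nextClustering S.1 B (sample n s q S.1 B), S.2 ∪ addedEdges S.1 B (sample n s q S.1 B))

/-- Clustering and spanner after `t` phases. -/
noncomputable def phases (E : Set (Sym2 V × ℕ)) (n s q : ℕ) : ℕ → Clustering V × Set (Sym2 V × ℕ)
  | 0 => (fun v => some (v, 0), ∅)
  | t + 1 => phase n s q (phases E n s q t)
      fun v => candidates (phases E n s q t).1 q v (incidentItems E v)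

theorem candidates_subset (f : Clustering V) (q : ℕ) (v : V) (I : Set (ℕ ×ₗ V)) :
    candidates f q v I ⊆ I := light_subset.trans (live_subset f v I)

/-- The node type may be infinite (identifiers), hence the finite set `X` outside which the lists
are empty. -/
theorem ncard_addedEdges_le (f : Clustering V) (B : V → Set (ℕ ×ₗ V)) (R : Set (Option V))
    (X : Finset V) (hX : ∀ v ∉ X, B v = ∅) (hB : ∀ v, (B v).Finite) :
    (addedEdges f B R).Finite ∧ (addedEdges f B R).ncard ≤ ∑ v ∈ X, (chosen f B R v).ncard := by
  classical
  have hfin : ∀ v, (chosen f B R v).Finite := fun v => (hB v).subset fun _ h => h.1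
  have h : addedEdges f B R = (X.biUnion fun v => (hfin v).toFinset.image
      fun a => (s(v, (ofLex a).2), (ofLex a).1) : Finset (Sym2 V × ℕ)) := by
    ext e
    simp only [addedEdges, mem_ofPred_eq, Finset.coe_biUnion, mem_iUnion, Finset.coe_image,
      Finite.coe_toFinset, mem_image, Finset.mem_coe]
    constructor
    · rintro ⟨v, a, ha, rfl⟩
      refine ⟨v, ?_, a, ha, rfl⟩
      by_contra hv
      have := ha.1
      rw [hX v hv] at this
      exact this
    · rintro ⟨v, -, a, ha, rfl⟩
      exact ⟨v, a, ha, rfl⟩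
  rw [h]
  refine ⟨Finset.finite_toSet _, ?_⟩
  rw [ncard_coe_finset]
  refine Finset.card_biUnion_le.trans (Finset.sum_le_sum fun v _ => ?_)
  rw [ncard_eq_toFinset_card _ (hfin v)]
  exact Finset.card_image_le

theorem centers_finite (f : Clustering V) (B : V → Set (ℕ ×ₗ V))
    (X : Finset V) (hX : ∀ v ∉ X, B v = ∅) (hB : ∀ v, (B v).Finite) : (centers f B).Finite := by
  refine (X.finite_toSet.biUnion fun v _ => (hB v).image (itemCenter f)).subset ?_
  rintro _ ⟨v, a, ha, rfl⟩
  refine mem_biUnion (x := v) ?_ ⟨a, ha, rfl⟩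
  by_contra hv
  rw [hX v hv] at ha
  exact ha

/-- If at most `s` clusters occur, the empty sample works: lists have at most `s < q` items, so none
has to be hit, and adding them entirely costs at most `n * s` edges. Otherwise `exists_sample`
applies. -/
theorem exists_goodSample {n s q : ℕ} (f : Clustering V) (B : V → Set (ℕ ×ₗ V)) (X : Finset V)
    (hXn : X.card ≤ n) (hn : 0 < n) (hs : 0 < s) (hsq : s < q)
    (hq : (n : ℝ) * (1 - 1 / (3 * s)) ^ q < 1 / 3)
    (hX : ∀ v ∉ X, B v = ∅) (hB : ∀ v, (B v).Finite) (hinj : ∀ v, InjOn (itemCenter f) (B v)) :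
    ∃ R, GoodSample n s q f B R := by
  classical
  have hfin := centers_finite f B X hX hB
  rcases le_or_gt (centers f B).ncard s with hm | hm
  · have hBs : ∀ v, (B v).ncard ≤ s := fun v => by
      rw [← (hinj v).ncard_image]
      refine (ncard_le_ncard ?_ hfin).trans hm
      rintro _ ⟨a, ha, rfl⟩
      exact ⟨v, a, ha, rfl⟩
    refine ⟨∅, empty_subset _, by simp, fun _ => rfl,
      fun v hv => absurd (hv.trans (hBs v)) (not_le.2 hsq), ?_⟩
    refine (ncard_addedEdges_le f B ∅ X hX hB).2.trans ?_
    calc _ ≤ ∑ _v ∈ X, s := Finset.sum_le_sum fun v _ =>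
          (ncard_le_ncard (fun _ h => h.1) (hB v)).trans (hBs v)
      _ = X.card * s := by simp
      _ ≤ 9 * n * s := Nat.mul_le_mul_right _ (by omega)
  · obtain ⟨R, hRM, hRs, hhit, hcost⟩ := exists_sample X n s q hXn hn hs hq (itemCenter f)
      (fun v => (hB v).toFinset) hfin.toFinset
      (by rw [← ncard_eq_toFinset_card _ hfin]; omega)
      (fun v _ => by simpa using hinj v)
      (fun v _ a ha => by
        rw [Finite.mem_toFinset] at ha ⊢
        exact ⟨v, a, ha, rfl⟩)
    refine ⟨R, fun c hc => hfin.mem_toFinset.1 (hRM hc), ?_, fun h => absurd h (not_le.2 hm), ?_,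
      ?_⟩
    · rwa [ncard_coe_finset, ncard_eq_toFinset_card _ hfin]
    · intro v hv
      by_cases hvX : v ∈ X
      · rw [ncard_eq_toFinset_card _ (hB v)] at hv
        obtain ⟨a, ha, haR⟩ := hhit v hvX hv
        exact ⟨a, (hB v).mem_toFinset.1 ha, haR⟩
      · rw [hX v hvX, ncard_empty] at hv
        omega
    · refine (ncard_addedEdges_le f B R X hX hB).2.trans (le_trans (le_of_eq ?_) hcost)
      refine Finset.sum_congr rfl fun v _ => ?_
      rw [← ncard_coe_finset]
      congr 1
      ext a
      simp [chosen]

theorem sample_good {n s q : ℕ} {f : Clustering V} {B : V → Set (ℕ ×ₗ V)}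
    (h : ∃ R, GoodSample n s q f B R) : GoodSample n s q f B (sample n s q f B) := by
  rw [sample, dif_pos h]
  exact h.choose_spec

theorem nextClustering_eq_some {f : Clustering V} {B : V → Set (ℕ ×ₗ V)} {R : Set (Option V)}
    {v : V} {x : V × ℕ} (h : nextClustering f B R v = some x) :
    ∃ a ∈ chosen f B R v, itemCenter f a ∈ R ∧ itemCenter f a = some x.1 ∧ (ofLex a).1 = x.2 := by
  unfold nextClustering at h
  split_ifs at h with h'
  obtain ⟨c, hc, rfl⟩ := Option.map_eq_some_iff.1 h
  exact ⟨h'.choose, h'.choose_spec.1, h'.choose_spec.2, hc, rfl⟩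

end Phase

/-! ## Stretch -/

section Stretch

variable {V : Type}

/-- There is a walk from `x` to `y` of at most `l` edges of `S`, each of weight at most `r`. -/
inductive Reach (S : Set (Sym2 V × ℕ)) (r : ℕ) : ℕ → V → V → Prop
  | refl (l : ℕ) (x : V) : Reach S r l x x
  | cons {l : ℕ} {x y z : V} {w : ℕ} (h : (s(x, y), w) ∈ S) (hw : w ≤ r) (h' : Reach S r l y z) :
      Reach S r (l + 1) x z

variable {S S' : Set (Sym2 V × ℕ)} {r r' l l' : ℕ} {x y z : V}

theorem Reach.mono (h : Reach S r l x y) (hS : S ⊆ S') (hr : r ≤ r') (hl : l ≤ l') :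
    Reach S' r' l' x y := by
  induction h generalizing l' with
  | refl => exact .refl _ _
  | cons h hw _ ih =>
    obtain ⟨m, rfl⟩ : ∃ m, l' = m + 1 := ⟨l' - 1, by omega⟩
    exact .cons (hS h) (hw.trans hr) (ih (by omega))

theorem Reach.trans (h : Reach S r l x y) (h' : Reach S r l' y z) : Reach S r (l + l') x z := by
  induction h with
  | refl => exact h'.mono subset_rfl le_rfl (by omega)
  | cons h hw _ ih =>
    rw [Nat.add_right_comm]
    exact .cons h hw (ih h')

theorem Reach.symm (h : Reach S r l x y) : Reach S r l y x := by
  induction h with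
  | refl => exact .refl _ _
  | cons h hw _ ih => exact ih.trans (.cons (Sym2.eq_swap ▸ h) hw (.refl 0 _))

end Stretch

/-! ### Invariants of the phases: stretch, number of clusters, size -/

section Correctness

variable {V : Type} [LinearOrder V]

/-- After `t` phases, every clustered node reaches its center by `t` edges within its radius, and
every edge is spanned or joins clustered nodes whose radii do not exceed its weight. -/
structure PhaseInvariant (E : Set (Sym2 V × ℕ)) (l t : ℕ)
    (S : Clustering V × Set (Sym2 V × ℕ)) : Prop where
  subset : S.2 ⊆ E
  reach : ∀ v x, S.1 v = some x → Reach S.2 x.2 t v x.1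
  covered : ∀ u v w, (s(u, v), w) ∈ E → Reach S.2 w l u v ∨
    (∃ x, S.1 u = some x ∧ x.2 ≤ w) ∧ ∃ y, S.1 v = some y ∧ y.2 ≤ w

/-- The node `u` has added an edge `z`, of weight at most `w`, to the cluster of `v`. Following `z`,
then the paths to the common center and back to `v`, takes `1 + t + t` edges; both radii are at most
`w`. -/
theorem reach_of_not_live {E : Set (Sym2 V × ℕ)} (hE : E.Finite) {n s q l t : ℕ}
    (hl : 2 * t + 1 ≤ l)
    {S : Clustering V × Set (Sym2 V × ℕ)} (hS : PhaseInvariant E l t S) {R : Set (Option V)}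
    (hR : GoodSample n s q S.1 (fun v => candidates S.1 q v (incidentItems E v)) R)
    {u v : V} {w : ℕ} (h : (s(u, v), w) ∈ E)
    (hu : ∃ x, S.1 u = some x ∧ x.2 ≤ w) (hv : ∃ y, S.1 v = some y ∧ y.2 ≤ w)
    (hnot : ¬ ∃ x, nextClustering S.1 (fun v => candidates S.1 q v (incidentItems E v)) R u = some x
      ∧ x.2 ≤ w) :
    Reach (S.2 ∪ addedEdges S.1 (fun v => candidates S.1 q v (incidentItems E v)) R) w l u v := by
  set B : V → Set (ℕ ×ₗ V) := fun v => candidates S.1 q v (incidentItems E v) with hBdef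
  have hJ : (live S.1 u (incidentItems E u)).Finite :=
    (incidentItems_finite hE u).subset (live_subset _ _ _)
  let b : ℕ ×ₗ V := toLex (w, v)
  have hb : b ∈ live S.1 u (incidentItems E u) := ⟨h, hu, hv⟩
  obtain ⟨z, hz, hzb, hzle⟩ : ∃ z ∈ chosen S.1 B R u, itemCenter S.1 z = itemCenter S.1 b ∧ z ≤ b := by
    -- Either `u` joins along an edge `a` heavier than `w`, and the cluster of `v` is listed before
    -- `a`; or its list contains no sampled cluster, so by `hit` it is not full, shows every cluster
    -- with a live edge from `u`, and is added entirely.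
    by_cases hex : ∃ a ∈ chosen S.1 B R u, itemCenter S.1 a ∈ R
    · have hnext : nextClustering S.1 B R u
          = (itemCenter S.1 hex.choose).map fun c => (c, (ofLex hex.choose).1) := by
        rw [nextClustering, dif_pos hex]
      obtain ⟨ha, -⟩ := hex.choose_spec
      set a := hex.choose
      obtain ⟨y, hy, -⟩ := ha.1.1.2.2
      have hwa : w < (ofLex a).1 := by
        by_contra hle
        refine hnot ⟨(y.1, (ofLex a).1), ?_, not_lt.1 hle⟩
        rw [hnext, itemCenter, hy]
        rfl
      have hba : b < a := (Prod.Lex.lt_iff).2 (.inl hwa)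
      obtain ⟨z, hz, hzb, hzle⟩ := exists_light_le hJ ha.1 hb hba
      exact ⟨z, ⟨hz, fun y hy hyz => ha.2 y hy (hyz.trans (hzle.trans_lt hba))⟩, hzb, hzle⟩
    · have hno : ∀ a ∈ B u, itemCenter S.1 a ∉ R := by
        intro a₀ ha₀ ha₀R
        obtain ⟨a, ⟨ha, haR⟩, hmin⟩ := Set.exists_min_image
          {a | a ∈ B u ∧ itemCenter S.1 a ∈ R} id
          ((hJ.subset light_subset).subset fun x hx => hx.1) ⟨a₀, ha₀, ha₀R⟩
        exact hex ⟨a, ⟨ha, fun y hy hya hyR => absurd (hmin y ⟨hy, hyR⟩) (not_le.2 hya)⟩, haR⟩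
      have hlt : (B u).ncard < q := by
        by_contra hle
        obtain ⟨a, ha, haR⟩ := hR.hit u (not_lt.1 hle)
        exact hno a ha haR
      obtain ⟨z, hz, hzb, hzle⟩ := exists_light_of_ncard_lt hJ hlt hb
      exact ⟨z, ⟨hz, fun y hy _ => hno y hy⟩, hzb, hzle⟩
  obtain ⟨y, hy, hyz⟩ := hz.1.1.2.2
  obtain ⟨y', hy', hyw⟩ := hv
  have hc : y.1 = y'.1 := by
    have := hzb
    simp only [itemCenter, b, ofLex_toLex] at this
    rw [hy, hy'] at this
    simpa using this
  have hzw : (ofLex z).1 ≤ w := by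
    rcases Prod.Lex.le_iff.1 hzle with h | h
    · exact h.le
    · exact h.1.le
  have h1 : Reach (S.2 ∪ addedEdges S.1 B R) w t (ofLex z).2 y.1 :=
    (hS.reach _ _ hy).mono subset_union_left (hyz.trans hzw) le_rfl
  have h2 : Reach (S.2 ∪ addedEdges S.1 B R) w t v y.1 :=
    hc ▸ (hS.reach _ _ hy').mono subset_union_left hyw le_rfl
  exact (Reach.cons (.inr ⟨u, z, hz, rfl⟩) hzw (h1.trans h2.symm)).mono subset_rfl le_rfl (by omega)

/-- A node joining along `a` reaches the center through the endpoint of `a`, whose radius is at most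
the weight of `a` by liveness; so that weight is a valid new radius. If an unspanned edge fails the
new radius condition at an end, `reach_of_not_live` spans it. -/
theorem PhaseInvariant.phase {E : Set (Sym2 V × ℕ)} (hE : E.Finite) {n s q l t : ℕ}
    (hl : 2 * t + 1 ≤ l) {S : Clustering V × Set (Sym2 V × ℕ)} (hS : PhaseInvariant E l t S)
    (hR : ∃ R, GoodSample n s q S.1 (fun v => candidates S.1 q v (incidentItems E v)) R) :
    PhaseInvariant E l (t + 1)
      (phase n s q S fun v => candidates S.1 q v (incidentItems E v)) := by
  have hR := sample_good hR
  set B : V → Set (ℕ ×ₗ V) := fun v => candidates S.1 q v (incidentItems E v)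
  set R := sample n s q S.1 B
  have hph : DistSpanner.phase n s q S B
      = (nextClustering S.1 B R, S.2 ∪ addedEdges S.1 B R) := rfl
  rw [hph]
  refine ⟨union_subset hS.subset ?_, ?_, ?_⟩
  · rintro _ ⟨v, a, ha, rfl⟩
    exact candidates_subset _ _ _ _ ha.1
  · intro v x hx
    obtain ⟨a, ha, -, hac, hax⟩ := nextClustering_eq_some hx
    obtain ⟨y, hy, hya⟩ := ha.1.1.2.2
    have hyx : y.1 = x.1 := by
      rw [itemCenter, hy] at hac
      simpa using hac
    refine .cons (.inr ⟨v, a, ha, rfl⟩) hax.le ?_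
    exact hyx ▸ (hS.reach _ _ hy).mono subset_union_left (hax ▸ hya) le_rfl
  · intro u v w h
    rcases hS.covered u v w h with h' | ⟨hu, hv⟩
    · exact .inl (h'.mono subset_union_left le_rfl le_rfl)
    by_cases h1 : ∃ x, nextClustering S.1 B R u = some x ∧ x.2 ≤ w
    · by_cases h2 : ∃ x, nextClustering S.1 B R v = some x ∧ x.2 ≤ w
      · exact .inr ⟨h1, h2⟩
      · exact .inl (reach_of_not_live hE hl hS hR (Sym2.eq_swap ▸ h) hv hu h2).symm
    · exact .inl (reach_of_not_live hE hl hS hR h hu hv h1)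

variable {E : Set (Sym2 V × ℕ)} {X : Finset V} {n s q k : ℕ}

theorem exists_goodSample_candidates (hE : E.Finite) (hEX : ∀ e ∈ E, ∀ v ∈ e.1, v ∈ X)
    (hXn : X.card ≤ n) (hn : 0 < n) (hs : 0 < s) (hsq : s < q)
    (hq : (n : ℝ) * (1 - 1 / (3 * s)) ^ q < 1 / 3) (f : Clustering V) :
    ∃ R, GoodSample n s q f (fun v => candidates f q v (incidentItems E v)) R := by
  refine exists_goodSample f _ X hXn hn hs hsq hq (fun v hv => ?_)
    (fun v => (incidentItems_finite hE v).subset (candidates_subset _ _ _ _))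
    fun v => light_injOn
  rw [eq_empty_iff_forall_notMem]
  intro a ha
  exact hv (hEX _ (candidates_subset _ _ _ _ ha) v (Sym2.mem_mk_left _ _))

theorem phaseInvariant_phases (hE : E.Finite)
    (hR : ∀ f, ∃ R, GoodSample n s q f (fun v => candidates f q v (incidentItems E v)) R) :
    ∀ t ≤ k, PhaseInvariant E (2 * k - 1) t (phases E n s q t)
  | 0, _ => ⟨empty_subset _, fun v x h => by
      obtain rfl : (v, 0) = x := by simpa [phases] using h
      exact .refl _ _, fun u v w _ => .inr ⟨⟨_, rfl, by simp⟩, ⟨_, rfl, by simp⟩⟩⟩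
  | t + 1, ht => (phaseInvariant_phases hE hR t (by omega)).phase hE (by omega) (hR _)

/-- The clusters that occur in some list after `t` phases. -/
def phaseCenters (E : Set (Sym2 V × ℕ)) (n s q t : ℕ) : Set (Option V) :=
  centers (phases E n s q t).1
    fun v => candidates (phases E n s q t).1 q v (incidentItems E v)

theorem phaseCenters_succ_subset (t : ℕ) : phaseCenters E n s q (t + 1) ⊆
    sample n s q (phases E n s q t).1
      fun v => candidates (phases E n s q t).1 q v (incidentItems E v) := by
  rintro _ ⟨v, a, ha, rfl⟩
  obtain ⟨y, hy, -⟩ := ha.1.2.2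
  obtain ⟨b, hb, hbR, hbc, -⟩ := nextClustering_eq_some hy
  rw [itemCenter, hy]
  exact (show some y.1 ∈ _ from hbc ▸ hbR)

/-- Only sampled clusters survive a phase, at most a fraction `1 / s` of those listed. -/
theorem ncard_phaseCenters_mul_le (hEX : ∀ e ∈ E, ∀ v ∈ e.1, v ∈ X)
    (hXn : X.card ≤ n)
    (hR : ∀ f, ∃ R, GoodSample n s q f (fun v => candidates f q v (incidentItems E v)) R) (t : ℕ) :
    (phaseCenters E n s q t).Finite ∧ (phaseCenters E n s q t).ncard * s ^ t ≤ n := by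
  classical
  induction t with
  | zero =>
    have hsub : phaseCenters E n s q 0 ⊆ (X.image some : Finset (Option V)) := by
      rintro _ ⟨v, a, ha, rfl⟩
      rw [Finset.coe_image]
      exact ⟨(ofLex a).2, hEX _ (candidates_subset _ _ _ _ ha) _ (Sym2.mem_mk_right _ _), rfl⟩
    refine ⟨(Finset.finite_toSet _).subset hsub, ?_⟩
    rw [pow_zero, mul_one]
    refine (ncard_le_ncard hsub (Finset.finite_toSet _)).trans ?_
    rw [ncard_coe_finset]
    exact Finset.card_image_le.trans hXn
  | succ t ih =>
    have hg := sample_good (hR (phases E n s q t).1)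
    have hsub := phaseCenters_succ_subset (E := E) (n := n) (s := s) (q := q) t
    have hfin := ih.1.subset hg.subset
    refine ⟨hfin.subset hsub, ?_⟩
    calc _ = (phaseCenters E n s q (t + 1)).ncard * s * s ^ t := by ring
      _ ≤ _ * s * s ^ t := Nat.mul_le_mul_right _ (Nat.mul_le_mul_right _
          (ncard_le_ncard hsub hfin))
      _ ≤ _ * s ^ t := Nat.mul_le_mul_right _ hg.card_le
      _ ≤ n := ih.2

theorem phases_spec (hE : E.Finite) (hEX : ∀ e ∈ E, ∀ v ∈ e.1, v ∈ X)
    (hXn : X.card ≤ n) (hn : 0 < n) (hs : 0 < s) (hsq : s < q)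
    (hq : (n : ℝ) * (1 - 1 / (3 * s)) ^ q < 1 / 3) (hk : 1 ≤ k) (hnk : n ≤ s ^ k) :
    (phases E n s q k).2 ⊆ E ∧ ∀ u v w, (s(u, v), w) ∈ E →
      Reach (phases E n s q k).2 w (2 * k - 1) u v := by
  have hR := exists_goodSample_candidates hE hEX hXn hn hs hsq hq
  have hinv := phaseInvariant_phases (k := k) hE hR k le_rfl
  refine ⟨hinv.subset, fun u v w h => (hinv.covered u v w h).resolve_right ?_⟩
  rintro ⟨⟨x, hx, -⟩, -⟩
  obtain ⟨t, rfl⟩ : ∃ t, k = t + 1 := ⟨k - 1, by omega⟩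
  -- From `n ≤ s ^ (t + 1)`, at most `s` clusters occur in the last phase; its sample is then empty
  -- by `GoodSample.empty`, and `x` cannot exist.
  have h1 := (ncard_phaseCenters_mul_le hEX hXn hR t).2
  have hle : (phaseCenters E n s q t).ncard ≤ s := by
    rw [pow_succ'] at hnk
    exact Nat.le_of_mul_le_mul_right (h1.trans hnk) (pow_pos hs t)
  have hemp := (sample_good (hR (phases E n s q t).1)).empty hle
  obtain ⟨a, -, haR, -⟩ := nextClustering_eq_some hx
  rw [hemp] at haR
  exact haR

theorem ncard_phases_le
    (hR : ∀ f, ∃ R, GoodSample n s q f (fun v => candidates f q v (incidentItems E v)) R) (t : ℕ) :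
    (phases E n s q t).2.ncard ≤ t * (9 * n * s) := by
  induction t with
  | zero => simp [phases]
  | succ t ih =>
    refine (ncard_union_le _ _).trans ?_
    rw [Nat.succ_mul]
    exact Nat.add_le_add ih (sample_good (hR _)).added

theorem radius_phases_le {W : ℕ} (hW : ∀ e ∈ E, e.2 ≤ W) {t : ℕ} {v : V} {x : V × ℕ}
    (h : (phases E n s q t).1 v = some x) : x.2 ≤ W := by
  cases t with
  | zero =>
    obtain rfl : (v, 0) = x := by simpa [phases] using h
    exact Nat.zero_le _
  | succ t =>
    obtain ⟨a, ha, -, -, hax⟩ := nextClustering_eq_some h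
    exact hax ▸ hW _ (candidates_subset _ _ _ _ ha.1)

end Correctness

/-! ## From short light walks to spanners -/

section Spanner

variable {V : Type} {n : ℕ}

/-- The weighted edges of `(G, w)`, after renaming the nodes. -/
def renamedEdges (G : SimpleGraph (Fin n)) (w : Sym2 (Fin n) → ℕ) (ident : Fin n → V) :
    Set (Sym2 V × ℕ) :=
  {x | ∃ e ∈ G.edgeSet, x = (e.map ident, w e)}

theorem renamedEdges_finite (G : SimpleGraph (Fin n)) (w : Sym2 (Fin n) → ℕ) (ident : Fin n → V) :
    (renamedEdges G w ident).Finite := by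
  refine ((toFinite G.edgeSet).image fun e => (e.map ident, w e)).subset ?_
  rintro _ ⟨e, he, rfl⟩
  exact ⟨e, he, rfl⟩

theorem mem_renamedEdges {G : SimpleGraph (Fin n)} {w : Sym2 (Fin n) → ℕ} {ident : Fin n → V}
    (hid : ident.Injective) {u : Fin n} {y : V} {r : ℕ} :
    (s(ident u, y), r) ∈ renamedEdges G w ident ↔
      ∃ v, G.Adj u v ∧ y = ident v ∧ r = w s(u, v) := by
  constructor
  · rintro ⟨e, he, heq⟩
    induction e with | _ a b
    simp only [Sym2.map_mk, Prod.mk.injEq, Sym2.eq_iff] at heq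
    obtain ⟨⟨h1, rfl⟩ | ⟨h1, rfl⟩, rfl⟩ := heq
    · obtain rfl := hid h1
      exact ⟨b, he, rfl, rfl⟩
    · obtain rfl := hid h1
      exact ⟨a, he.symm, rfl, by rw [Sym2.eq_swap]⟩
  · rintro ⟨v, h, rfl, rfl⟩
    exact ⟨s(u, v), h, rfl⟩

theorem wdist_triangle (H : SimpleGraph V) (w : Sym2 V → ℕ) (x y z : V) :
    wdist H w x z ≤ wdist H w x y + wdist H w y z := by
  unfold wdist
  refine ENat.le_iInf_add_iInf fun p p' => iInf_le_of_le (p.append p') ?_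
  rw [SimpleGraph.Walk.edges_append, List.map_append, List.sum_append]
  push_cast
  exact le_rfl

theorem wdist_self (H : SimpleGraph V) (w : Sym2 V → ℕ) (x : V) : wdist H w x x = 0 :=
  nonpos_iff_eq_zero.1 (iInf_le_of_le .nil (by simp))

theorem wdist_le_of_adj {H : SimpleGraph V} (w : Sym2 V → ℕ) {x y : V} (h : H.Adj x y) :
    wdist H w x y ≤ w s(x, y) :=
  iInf_le_of_le (.cons h .nil) (by simp)

theorem Reach.wdist_le {H : SimpleGraph (Fin n)} {w : Sym2 (Fin n) → ℕ} {ident : Fin n → V}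
    (hid : ident.Injective) {r l : ℕ} {x y : V} (h : Reach (renamedEdges H w ident) r l x y)
    {u v : Fin n} (hx : x = ident u) (hy : y = ident v) :
    wdist H w u v ≤ ((l * r : ℕ) : ℕ∞) := by
  induction h generalizing u with
  | refl =>
    obtain rfl := hid (hx.symm.trans hy)
    rw [wdist_self]
    exact zero_le
  | @cons l x y z w' h hw _ ih =>
    subst hx
    obtain ⟨m, hm, rfl, rfl⟩ := (mem_renamedEdges hid).1 h
    refine (wdist_triangle H w u m v).trans ((add_le_add (wdist_le_of_adj w hm) (ih rfl hy)).trans ?_)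
    rw [← Nat.cast_add, Nat.cast_le]
    rw [Nat.succ_mul]
    omega

/-- Stretch needs checking on single edges only: the bounds add up along a walk. -/
theorem isSpanner_of_edges {G H : SimpleGraph V} {w : Sym2 V → ℕ} {l : ℕ} (hl : 0 < l) (hH : H ≤ G)
    (h : ∀ u v, G.Adj u v → wdist H w u v ≤ ((l * w s(u, v) : ℕ) : ℕ∞)) : IsSpanner l G w H := by
  refine ⟨hH, fun u v => ?_⟩
  have key : ∀ p : G.Walk u v, wdist H w u v ≤ ((l * (p.edges.map w).sum : ℕ) : ℕ∞) := by
    intro p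
    induction p with
    | nil => rw [wdist_self]; exact zero_le
    | cons h' p ih =>
      refine (wdist_triangle H w _ _ _).trans ((add_le_add (h _ _ h') ih).trans ?_)
      rw [← Nat.cast_add, Nat.cast_le, SimpleGraph.Walk.edges_cons, List.map_cons, List.sum_cons,
        mul_add]
  -- Without a walk the right side is `l * ⊤`, which is `⊤` only because `0 < l`.
  rcases isEmpty_or_nonempty (G.Walk u v) with hw | hw
  · have : wdist G w u v = ⊤ := iInf_of_empty _
    rw [this, ENat.mul_top (by exact_mod_cast hl.ne')]
    exact le_top
  · obtain ⟨p, hp⟩ := ENat.exists_eq_iInf fun p : G.Walk u v => (((p.edges.map w).sum : ℕ) : ℕ∞)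
    refine (key p).trans (le_of_eq ?_)
    rw [Nat.cast_mul, hp, wdist]

theorem exists_isSpanner {G : SimpleGraph (Fin n)} {w : Sym2 (Fin n) → ℕ} {ident : Fin n → V}
    (hid : ident.Injective) {l : ℕ} (hl : 0 < l) {S : Set (Sym2 V × ℕ)} (hS : S ⊆ renamedEdges G w ident)
    (hreach : ∀ x y r, (s(x, y), r) ∈ renamedEdges G w ident → Reach S r l x y) :
    ∃ H : SimpleGraph (Fin n), IsSpanner l G w H ∧ H.edgeSet.ncard ≤ S.ncard ∧
      S = renamedEdges H w ident := by
  let H := SimpleGraph.fromEdgeSet {e | e ∈ G.edgeSet ∧ (e.map ident, w e) ∈ S}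
  have hHe : ∀ e, e ∈ H.edgeSet ↔ e ∈ G.edgeSet ∧ (e.map ident, w e) ∈ S := by
    intro e
    simp only [H, SimpleGraph.edgeSet_fromEdgeSet, mem_sdiff, mem_ofPred_eq]
    exact ⟨fun h => h.1, fun h => ⟨h, fun hd => G.not_isDiag_of_mem_edgeSet h.1 hd⟩⟩
  have hSH : S = renamedEdges H w ident := by
    ext x
    constructor
    · intro hx
      obtain ⟨e, he, rfl⟩ := hS hx
      exact ⟨e, (hHe e).2 ⟨he, hx⟩, rfl⟩
    · rintro ⟨e, he, rfl⟩
      exact ((hHe e).1 he).2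
  refine ⟨H, isSpanner_of_edges hl (fun u v h => ((hHe s(u, v)).1 h).1) fun u v h => ?_, ?_, hSH⟩
  · exact (hSH ▸ hreach _ _ _ ((mem_renamedEdges hid).2 ⟨v, h, rfl, rfl⟩)).wdist_le hid rfl rfl
  · refine ncard_le_ncard_of_injOn (fun e => (e.map ident, w e)) (fun e he => ((hHe e).1 he).2) ?_
      ((renamedEdges_finite G w ident).subset hS)
    intro e _ e' _ h
    exact Sym2.map.injective hid (Prod.ext_iff.1 h).1

end Spanner

/-! ## Encodings -/

section Encoding

/-- An enumeration of a finite set. -/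
noncomputable def pick {α : Type*} (C : Set α) (j : ℕ) : Option α :=
  open Classical in if h : C.Finite then h.toFinset.toList[j]? else none

theorem mem_of_pick {α : Type*} {C : Set α} {j : ℕ} {a : α} (h : pick C j = some a) : a ∈ C := by
  unfold pick at h
  split_ifs at h with hC
  simpa using List.mem_of_getElem? h

theorem exists_pick {α : Type*} {C : Set α} (hC : C.Finite) {q : ℕ} (hq : C.ncard ≤ q) {a : α}
    (ha : a ∈ C) : ∃ j < q, pick C j = some a := by
  obtain ⟨j, hj, h⟩ := List.mem_iff_getElem.1 (Finset.mem_toList.2 (hC.mem_toFinset.2 ha))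
  refine ⟨j, lt_of_lt_of_le hj ?_, by rw [pick, dif_pos hC, List.getElem?_eq_getElem hj, h]⟩
  rwa [Finset.length_toList, ← ncard_eq_toFinset_card _ hC]

/-- A decoding of words of `β` bits into optional elements of a set with fewer than `2 ^ β`
elements. -/
theorem exists_decoder {α : Type*} {β : ℕ} {A : Set α} (hA : A.Finite) (h : A.ncard + 1 ≤ 2 ^ β) :
    ∃ dec : (Fin β → Bool) → Option α, (∃ m, dec m = none) ∧ ∀ a ∈ A, ∃ m, dec m = some a := by
  have hcard : Fintype.card (Fin β → Bool) = 2 ^ β := by simp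
  let e := (Fintype.equivFinOfCardEq hcard)
  -- The index `A.ncard` is past the end of the enumeration and decodes to `none`; this is the extra
  -- `1` in the bound.
  refine ⟨fun m => pick A (e m), ⟨e.symm ⟨A.ncard, by omega⟩, ?_⟩, fun a ha => ?_⟩
  · simp only [Equiv.apply_symm_apply]
    rw [pick, dif_pos hA, List.getElem?_eq_none_iff, Finset.length_toList, ← ncard_eq_toFinset_card _ hA]
  · obtain ⟨j, hj, hja⟩ := exists_pick hA (q := 2 ^ β) (by omega) ha
    exact ⟨e.symm ⟨j, hj⟩, by simp only [Equiv.apply_symm_apply, hja]⟩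

/-- The elements fill the first words; the surplus words decode to `none`. -/
theorem exists_words {α : Type*} {β M : ℕ} {dec : (Fin β → Bool) → Option α}
    (hnone : ∃ m, dec m = none) {C : Set α} (hC : C.Finite) (hM : C.ncard ≤ M)
    (hdec : ∀ a ∈ C, ∃ m, dec m = some a) :
    ∃ g : Fin M → Fin β → Bool, {a | ∃ i, dec (g i) = some a} = C := by
  have h : ∀ j, ∃ m, dec m = pick C j := fun j => by
    rcases hp : pick C j with _ | a
    · exact hnone
    · exact hdec a (mem_of_pick hp)
  choose g hg using h
  refine ⟨fun i => g i, ?_⟩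
  ext a
  simp only [mem_ofPred_eq, hg]
  constructor
  · rintro ⟨i, hi⟩
    exact mem_of_pick hi
  · intro ha
    obtain ⟨j, hj, hja⟩ := exists_pick hC hM ha
    exact ⟨⟨j, hj⟩, hja⟩

theorem pow_bits_bound {n : ℕ} (hn : 2 ≤ n) (c d : ℕ) :
    (n ^ c + 1) * n ^ d + 1 ≤ 2 ^ ((c + d + 2) * Nat.clog 2 n) := by
  have h1 : 1 ≤ n ^ c := Nat.one_le_pow _ _ (by omega)
  have h2 : 1 ≤ n ^ (c + d + 1) := Nat.one_le_pow _ _ (by omega)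
  calc (n ^ c + 1) * n ^ d + 1 ≤ (n ^ c * n) * n ^ d + n ^ (c + d + 1) := by
        gcongr
        nlinarith
    _ = 2 * n ^ (c + d + 1) := by ring
    _ ≤ n * n ^ (c + d + 1) := Nat.mul_le_mul_right _ hn
    _ = n ^ (c + d + 2) := by ring
    _ ≤ (2 ^ Nat.clog 2 n) ^ (c + d + 2) := Nat.pow_le_pow_left (Nat.le_pow_clog (by norm_num) n) _
    _ = _ := by rw [← pow_mul, mul_comm]

end Encoding

/-! ## The algorithm in the broadcast congested clique -/

section Clique

/-- The edges of a node, as `(weight, identifier)`. -/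
def LocalInput.items (I : LocalInput) : Set (ℕ ×ₗ ℕ) :=
  {a | ((ofLex a).2, (ofLex a).1) ∈ I.incident}

theorem items_localInput {n : ℕ} {G : SimpleGraph (Fin n)} {w : Sym2 (Fin n) → ℕ}
    {ident : Fin n → ℕ} (hid : ident.Injective) (u : Fin n) :
    (localInput G w ident u).items = incidentItems (renamedEdges G w ident) (ident u) := by
  ext a
  refine Iff.trans ?_ (mem_renamedEdges hid).symm
  simp [LocalInput.items, localInput]

/-- The state of a node: its input, what all nodes know after the last phase, the number of rounds
of the current phase, and the edges announced in this phase. -/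
structure CliqueState where
  input : LocalInput
  known : Clustering ℕ × Set (Sym2 ℕ × ℕ)
  round : ℕ
  heard : Set (ℕ × (ℕ ×ₗ ℕ))

/-- Every phase takes `q` rounds, in which each node announces its candidates. -/
noncomputable def cliqueAlgorithm {β : ℕ} (dec : (Fin β → Bool) → Option (ℕ ×ₗ ℕ)) (n s q : ℕ) :
    BCCAlgorithm β where
  State := CliqueState
  init I := ⟨I, (fun v => some (v, 0), ∅), 0, ∅⟩
  send σ := Function.invFun dec (pick (candidates σ.known.1 q σ.input.ident σ.input.items) σ.round)
  receive σ msgs :=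
    let heard := σ.heard ∪ {x | ∃ m, (x.1, m) ∈ msgs ∧ dec m = some x.2}
    if σ.round + 1 = q then
      ⟨σ.input, phase n s q σ.known fun v => {a | (v, a) ∈ heard}, 0, ∅⟩
    else ⟨σ.input, σ.known, σ.round + 1, heard⟩
  output σ := σ.known.2

variable {β : ℕ} {dec : (Fin β → Bool) → Option (ℕ ×ₗ ℕ)} {n s q : ℕ} {G : SimpleGraph (Fin n)}
  {w : Sym2 (Fin n) → ℕ} {ident : Fin n → ℕ}

/-- The edges announced in the first `j` rounds of phase `t + 1`. -/
def announced (E : Set (Sym2 ℕ × ℕ)) (ident : Fin n → ℕ) (s q t j : ℕ) : Set (ℕ × (ℕ ×ₗ ℕ)) :=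
  {x | ∃ u, ident u = x.1 ∧ ∃ i < j, pick (candidates (phases E n s q t).1 q (ident u)
    (incidentItems E (ident u))) i = some x.2}

/-- The state of `v` after `t` phases and `j` further rounds. -/
noncomputable def cliqueStateAt (G : SimpleGraph (Fin n)) (w : Sym2 (Fin n) → ℕ)
    (ident : Fin n → ℕ) (s q t j : ℕ) (v : Fin n) : CliqueState :=
  ⟨localInput G w ident v, phases (renamedEdges G w ident) n s q t, j,
    announced (renamedEdges G w ident) ident s q t j⟩

/-- There are at most `q` candidates, so `q` rounds announce them all; a number that is no
identifier has no incident edges. -/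
theorem announced_eq_candidates (y t : ℕ) :
    {a | (y, a) ∈ announced (renamedEdges G w ident) ident s q t q} =
      candidates (phases (renamedEdges G w ident) n s q t).1 q y
        (incidentItems (renamedEdges G w ident) y) := by
  ext a
  constructor
  · rintro ⟨u, rfl, i, -, h⟩
    exact mem_of_pick h
  · intro ha
    obtain ⟨u, rfl⟩ : ∃ u, ident u = y := by
      obtain ⟨e, -, he⟩ := candidates_subset _ _ _ _ ha
      have : y ∈ e.map ident := by
        rw [← show s(y, (ofLex a).2) = e.map ident from (Prod.ext_iff.1 he).1]
        exact Sym2.mem_mk_left _ _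
      obtain ⟨u, -, hu⟩ := Sym2.mem_map.1 this
      exact ⟨u, hu⟩
    have hfin := incidentItems_finite (renamedEdges_finite G w ident) (ident u)
    obtain ⟨i, hi, h⟩ := exists_pick (hfin.subset (candidates_subset _ q _ _))
      (ncard_light_le (hfin.subset (live_subset _ _ _))) ha
    exact ⟨u, rfl, i, hi, h⟩

theorem announced_succ {E : Set (Sym2 ℕ × ℕ)} (hnone : ∃ m, dec m = none)
    (hdec : ∀ u, ∀ a ∈ incidentItems E (ident u), ∃ m, dec m = some a) (t j : ℕ) :
    announced E ident s q t j ∪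
        {x | ∃ m, (x.1, m) ∈ range (fun u => (ident u, Function.invFun dec
          (pick (candidates (phases E n s q t).1 q (ident u) (incidentItems E (ident u))) j))) ∧
          dec m = some x.2} =
      announced E ident s q t (j + 1) := by
  have hpick : ∀ u, dec (Function.invFun dec (pick (candidates (phases E n s q t).1 q (ident u)
      (incidentItems E (ident u))) j)) = pick (candidates (phases E n s q t).1 q (ident u)
      (incidentItems E (ident u))) j := by
    intro u
    apply Function.invFun_eq
    rcases hp : pick _ j with _ | a
    · exact hnone
    · exact hdec u a (candidates_subset _ _ _ _ (mem_of_pick hp))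
  ext ⟨y, a⟩
  simp only [announced, mem_union, mem_ofPred_eq, mem_range, Prod.mk.injEq]
  constructor
  · rintro (⟨u, hu, i, hi, h⟩ | ⟨_, ⟨u, hu, rfl⟩, h⟩)
    · exact ⟨u, hu, i, by omega, h⟩
    · exact ⟨u, hu, j, by omega, (hpick u).symm.trans h⟩
  · rintro ⟨u, hu, i, hi, h⟩
    rcases Nat.lt_succ_iff_lt_or_eq.1 hi with hi | rfl
    · exact .inl ⟨u, hu, i, hi, h⟩
    · exact .inr ⟨_, ⟨u, hu, rfl⟩, (hpick u).trans h⟩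

theorem announced_zero (E : Set (Sym2 ℕ × ℕ)) (t : ℕ) : announced E ident s q t 0 = ∅ := by
  simp [announced]

theorem cliqueAlgorithm_receive (hid : ident.Injective) (hnone : ∃ m, dec m = none)
    (hdec : ∀ u, ∀ a ∈ incidentItems (renamedEdges G w ident) (ident u), ∃ m, dec m = some a)
    (t j : ℕ) (v : Fin n) :
    (cliqueAlgorithm dec n s q).receive (cliqueStateAt G w ident s q t j v)
        (range fun u => (ident u, (cliqueAlgorithm dec n s q).send
          (cliqueStateAt G w ident s q t j u))) =
      if j + 1 = q then cliqueStateAt G w ident s q (t + 1) 0 v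
      else cliqueStateAt G w ident s q t (j + 1) v := by
  have hident : ∀ u, (localInput G w ident u).ident = ident u := fun _ => rfl
  simp only [cliqueAlgorithm, cliqueStateAt, items_localInput hid, hident,
    announced_succ hnone hdec, announced_zero]
  split_ifs with hjq
  · simp only [hjq, announced_eq_candidates]
    rfl
  · rfl

theorem cliqueAlgorithm_run (hq : 0 < q) (hid : ident.Injective) (hnone : ∃ m, dec m = none)
    (hdec : ∀ u, ∀ a ∈ incidentItems (renamedEdges G w ident) (ident u), ∃ m, dec m = some a)
    (t : ℕ) : ∀ j < q, ∀ v, (cliqueAlgorithm dec n s q).run G w ident (t * q + j) v =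
      cliqueStateAt G w ident s q t j v := by
  have hstep : ∀ t j, (∀ v, (cliqueAlgorithm dec n s q).run G w ident (t * q + j) v =
      cliqueStateAt G w ident s q t j v) →
      ∀ v, (cliqueAlgorithm dec n s q).run G w ident (t * q + j + 1) v =
        if j + 1 = q then cliqueStateAt G w ident s q (t + 1) 0 v
        else cliqueStateAt G w ident s q t (j + 1) v := by
    intro t j ih v
    rw [BCCAlgorithm.run]
    simp only [ih]
    exact cliqueAlgorithm_receive hid hnone hdec t j v
  have hsucc : ∀ t, (∀ v, (cliqueAlgorithm dec n s q).run G w ident (t * q) v =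
      cliqueStateAt G w ident s q t 0 v) → ∀ j < q, ∀ v,
      (cliqueAlgorithm dec n s q).run G w ident (t * q + j) v =
        cliqueStateAt G w ident s q t j v := by
    intro t h0 j
    induction j with
    | zero => exact fun _ => h0
    | succ j ih =>
      intro hj v
      exact (hstep t j (ih (by omega)) v).trans (if_neg (by omega))
  induction t with
  | zero =>
    refine hsucc 0 fun v => ?_
    rw [zero_mul, BCCAlgorithm.run, cliqueStateAt, announced_zero]
    rfl
  | succ t ih =>
    refine hsucc (t + 1) fun v => ?_
    -- The last round of a phase resets the counter, so the state after `(t + 1) * q` rounds is that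
    -- of round `0` of the next phase.
    have := (hstep t (q - 1) (ih _ (by omega)) v).trans (if_pos (by omega))
    rwa [add_assoc, Nat.sub_add_cancel hq, ← Nat.succ_mul] at this

theorem cliqueAlgorithm_output (hq : 0 < q) (hid : ident.Injective) (hnone : ∃ m, dec m = none)
    (hdec : ∀ u, ∀ a ∈ incidentItems (renamedEdges G w ident) (ident u), ∃ m, dec m = some a)
    (t : ℕ) (v : Fin n) : (cliqueAlgorithm dec n s q).output
      ((cliqueAlgorithm dec n s q).run G w ident (t * q) v) =
      (phases (renamedEdges G w ident) n s q t).2 :=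
  congrArg (cliqueAlgorithm dec n s q).output (cliqueAlgorithm_run hq hid hnone hdec t 0 hq v)

end Clique

/-! ## The multipass streaming algorithm -/

section Streaming

variable {n M q β : ℕ}

/-- What is stored between two stream items: clustering and spanner of the last phase, and the
candidates of every node among the edges seen in this pass. -/
abbrev StreamState (n : ℕ) : Type :=
  (Clustering (Fin n) × Set (Sym2 (Fin n) × ℕ)) × (Fin n → Set (ℕ ×ₗ Fin n))

/-- The states that occur when the weights are at most `W`. -/
structure StreamState.Bounded (M q W : ℕ) (σ : StreamState n) : Prop where
  radius : ∀ v x, σ.1.1 v = some x → x.2 ≤ W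
  edges_le : ∀ e ∈ σ.1.2, e.2 ≤ W
  edges_ncard : σ.1.2.ncard ≤ M
  items_le : ∀ v, ∀ a ∈ σ.2 v, (ofLex a).1 ≤ W
  items_ncard : ∀ v, (σ.2 v).ncard ≤ q

theorem finite_ncard_le_of_injective {T : Type*} {W d : ℕ} {A : Set T} (f : T → ℕ × Fin d)
    (hf : f.Injective) (hA : ∀ a ∈ A, (f a).1 ≤ W) : A.Finite ∧ A.ncard ≤ (W + 1) * d := by
  have hmap : MapsTo f A (Finset.range (W + 1) ×ˢ Finset.univ : Finset (ℕ × Fin d)) := by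
    intro a ha
    simpa [Nat.lt_succ_iff] using hA a ha
  refine ⟨Finite.of_injOn hmap hf.injOn (Finset.finite_toSet _), ?_⟩
  refine (ncard_le_ncard_of_injOn f hmap hf.injOn (Finset.finite_toSet _)).trans ?_
  rw [ncard_coe_finset]
  simp

/-- The memory can be decoded so that every bounded state is represented. -/
theorem exists_memory_decoder (hn : 2 ≤ n) (c M q : ℕ) :
    ∃ D : Memory (n + (M + n * q)) ((c + 4) * Nat.clog 2 n) → StreamState n,
      ∀ σ : StreamState n, σ.Bounded M q (n ^ c) → ∃ m, D m = σ := by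
  -- All three kinds of words pair a weight with a node or an edge, and nodes and edges both inject
  -- into `Fin (n ^ 2)`.
  have hbits := pow_bits_bound hn c 2
  have hinj2 : ∃ g : Fin n → Fin (n ^ 2), g.Injective :=
    ⟨Fin.castLE (Nat.le_self_pow (by norm_num) n), Fin.castLE_injective _⟩
  obtain ⟨g, hg⟩ := hinj2
  obtain ⟨g', hg'⟩ : ∃ g : Sym2 (Fin n) → Fin (n ^ 2), g.Injective := by
    have : Fintype.card (Sym2 (Fin n)) ≤ Fintype.card (Fin (n ^ 2)) := by
      refine (Fintype.card_le_of_surjective (fun p : Fin n × Fin n => s(p.1, p.2))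
        fun e => ?_).trans (by simp [sq])
      induction e with | _ x y
      exact ⟨(x, y), rfl⟩
    obtain ⟨f⟩ := Function.Embedding.nonempty_of_card_le this
    exact ⟨f, f.injective⟩
  have h1 := finite_ncard_le_of_injective (A := {x : Fin n × ℕ | x.2 ≤ n ^ c})
    (fun x => (x.2, g x.1)) (fun x y h => Prod.ext (hg (Prod.ext_iff.1 h).2) (Prod.ext_iff.1 h).1)
    fun _ h => h
  have h2 := finite_ncard_le_of_injective (A := {x : Sym2 (Fin n) × ℕ | x.2 ≤ n ^ c})
    (fun x => (x.2, g' x.1)) (fun x y h => Prod.ext (hg' (Prod.ext_iff.1 h).2) (Prod.ext_iff.1 h).1)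
    fun _ h => h
  have h3 := finite_ncard_le_of_injective (A := {x : ℕ ×ₗ Fin n | (ofLex x).1 ≤ n ^ c})
    (fun x => ((ofLex x).1, g (ofLex x).2))
    (fun x y h => ofLex.injective (Prod.ext (Prod.ext_iff.1 h).1 (hg (Prod.ext_iff.1 h).2)))
    fun _ h => h
  obtain ⟨d₁, hd₁, hd₁'⟩ := exists_decoder h1.1 ((Nat.add_le_add_right h1.2 1).trans hbits)
  obtain ⟨d₂, hd₂, hd₂'⟩ := exists_decoder h2.1 ((Nat.add_le_add_right h2.2 1).trans hbits)
  obtain ⟨d₃, hd₃, hd₃'⟩ := exists_decoder h3.1 ((Nat.add_le_add_right h3.2 1).trans hbits)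
  let e : Fin n ⊕ (Fin M ⊕ Fin n × Fin q) ≃ Fin (n + (M + n * q)) :=
    Fintype.equivFinOfCardEq (by simp)
  refine ⟨fun m => ((fun v => d₁ (m (e (.inl v))),
    {x | ∃ i, d₂ (m (e (.inr (.inl i)))) = some x}),
    fun v => {a | ∃ j, d₃ (m (e (.inr (.inr (v, j))))) = some a}), fun σ hσ => ?_⟩
  have hr₁ : ∀ v, ∃ m, d₁ m = σ.1.1 v := fun v => by
    rcases hv : σ.1.1 v with _ | x
    · exact hd₁
    · exact hd₁' x (hσ.radius v x hv)
  choose r₁ hr₁ using hr₁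
  obtain ⟨r₂, hr₂⟩ := exists_words hd₂ (h2.1.subset hσ.edges_le) hσ.edges_ncard
    fun x hx => hd₂' x (hσ.edges_le x hx)
  have hr₃ := fun v => exists_words hd₃ (h3.1.subset (hσ.items_le v)) (hσ.items_ncard v)
    fun x hx => hd₃' x (hσ.items_le v x hx)
  choose r₃ hr₃ using hr₃
  refine ⟨fun i => Sum.elim r₁ (Sum.elim r₂ fun p => r₃ p.1 p.2) (e.symm i), ?_⟩
  simp only [Equiv.symm_apply_apply, Sum.elim_inl, Sum.elim_inr, hr₁, hr₂, hr₃]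

/-- Each pass computes the candidates of every node and ends with the update of the phase. -/
noncomputable def streamAlgorithm {S : ℕ} (D : Memory S β → StreamState n) (s q : ℕ) :
    StreamingAlgorithm n S β where
  init := Function.invFun D ((fun v => some (v, 0), ∅), fun _ => ∅)
  step m x := Function.invFun D ((D m).1, fun v => light (itemCenter (D m).1.1) q
    ((D m).2 v ∪ live (D m).1.1 v (incidentItems {x} v)))
  endPass m := Function.invFun D (phase n s q (D m).1 (D m).2, fun _ => ∅)
  output m := (D m).1.2

variable {S s k W : ℕ} {D : Memory S β → StreamState n} {E : Set (Sym2 (Fin n) × ℕ)}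

/-- Every state that occurs is bounded, so storing it by `Function.invFun D` loses nothing. -/
theorem bounded_phases (hW : ∀ e ∈ E, e.2 ≤ W)
    (hH : ∀ t, (phases E n s q t).2.ncard ≤ t * (9 * n * s)) (hHE : ∀ t ≤ k, (phases E n s q t).2 ⊆ E)
    {t : ℕ} (ht : t ≤ k) {L : Set (Sym2 (Fin n) × ℕ)} (hL : L ⊆ E) (hLfin : L.Finite) :
    StreamState.Bounded (k * (9 * n * s)) q W
      (phases E n s q t, fun v => candidates (phases E n s q t).1 q v (incidentItems L v)) where
  radius _ _ h := radius_phases_le hW h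
  edges_le e he := hW e (hHE t ht he)
  edges_ncard := (hH t).trans (Nat.mul_le_mul_right _ ht)
  items_le _ _ ha := hW _ (hL (candidates_subset _ _ _ _ ha))
  items_ncard v := ncard_light_le ((incidentItems_finite hLfin v).subset (live_subset _ _ _))

theorem candidates_empty (f : Clustering (Fin n)) (v : Fin n) :
    candidates f q v (incidentItems ∅ v) = ∅ :=
  subset_empty_iff.1 (candidates_subset f q v _)

theorem candidates_insert (f : Clustering (Fin n)) (v : Fin n) {L : Set (Sym2 (Fin n) × ℕ)}
    (hL : L.Finite) (x : Sym2 (Fin n) × ℕ) :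
    light (itemCenter f) q
        (candidates f q v (incidentItems L v) ∪ live f v (incidentItems {x} v)) =
      candidates f q v (incidentItems (L ∪ {x}) v) := by
  rw [candidates, light_light_union ((incidentItems_finite hL v).subset (live_subset _ _ _))
    ((incidentItems_finite (finite_singleton x) v).subset (live_subset _ _ _)), ← live_union]
  rfl

theorem streamAlgorithm_run (hD : ∀ σ : StreamState n, σ.Bounded (k * (9 * n * s)) q W → ∃ m, D m = σ)
    (hW : ∀ e ∈ E, e.2 ≤ W) (hH : ∀ t, (phases E n s q t).2.ncard ≤ t * (9 * n * s))
    (hHE : ∀ t ≤ k, (phases E n s q t).2 ⊆ E) {stream : List (Sym2 (Fin n) × ℕ)}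
    (hE : ∀ x, x ∈ stream ↔ x ∈ E) :
    ∀ t ≤ k, D ((streamAlgorithm D s q).run stream t) = (phases E n s q t, fun _ => ∅) := by
  have hinv : ∀ t ≤ k, ∀ L ⊆ E, L.Finite → D (Function.invFun D (phases E n s q t,
      fun v => candidates (phases E n s q t).1 q v (incidentItems L v))) = (phases E n s q t,
      fun v => candidates (phases E n s q t).1 q v (incidentItems L v)) := fun t ht L hL hf =>
    Function.invFun_eq (hD _ (bounded_phases hW hH hHE ht hL hf))
  have hinv0 : ∀ t ≤ k, D (Function.invFun D (phases E n s q t, fun _ => ∅)) =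
      (phases E n s q t, fun _ => ∅) := fun t ht => by
    simpa only [candidates_empty] using hinv t ht ∅ (empty_subset _) finite_empty
  -- Here `L` is the set of edges already read in the current pass; it has to vary in the induction
  -- on the rest of the stream.
  have hfold : ∀ t ≤ k, ∀ (l : List (Sym2 (Fin n) × ℕ)), (∀ x ∈ l, x ∈ E) → ∀ L ⊆ E, L.Finite →
      ∀ m, D m = (phases E n s q t,
        fun v => candidates (phases E n s q t).1 q v (incidentItems L v)) →
      D (l.foldl (streamAlgorithm D s q).step m) = (phases E n s q t,
        fun v => candidates (phases E n s q t).1 q v (incidentItems (L ∪ {x | x ∈ l}) v)) := by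
    intro t ht l
    induction l with
    | nil =>
      intro _ L _ _ m hm
      simpa using hm
    | cons x l ih =>
      intro hl L hL hf m hm
      have hL' : L ∪ {x} ⊆ E :=
        union_subset hL (singleton_subset_iff.2 (hl x List.mem_cons_self))
      have hf' := hf.union (finite_singleton x)
      have hset : L ∪ {y | y ∈ x :: l} = L ∪ {x} ∪ {y | y ∈ l} := by
        ext y
        simp only [mem_union, mem_ofPred_eq, List.mem_cons, mem_singleton_iff, or_assoc]
      rw [List.foldl_cons, hset]
      refine ih (fun y hy => hl y (List.mem_cons_of_mem _ hy)) _ hL' hf' _ ?_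
      rw [← hinv t ht _ hL' hf']
      simp only [streamAlgorithm, hm, candidates_insert _ _ hf]
  intro t
  induction t with
  | zero => exact fun _ => hinv0 0 (Nat.zero_le _)
  | succ t ih =>
    intro ht
    have h := hfold t (by omega) stream (fun x hx => (hE x).1 hx) ∅ (empty_subset _) finite_empty
      ((streamAlgorithm D s q).run stream t) (by simpa only [candidates_empty] using ih (by omega))
    have hset : ∅ ∪ {x | x ∈ stream} = E := by
      ext x
      simp [hE]
    rw [hset] at h
    rw [StreamingAlgorithm.run, ← hinv0 (t + 1) ht]
    simp only [streamAlgorithm] at h ⊢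
    rw [h]
    rfl

end Streaming

/-! ## Parameters -/

section Parameters

/-- Each block of `3 s` factors is at most `exp (-1) ≤ 1 / 2`; `Nat.clog 2 n` blocks cancel `n`, and
two more leave `1 / 4`. -/
theorem mul_one_sub_pow_lt {n s : ℕ} (hs : 0 < s) :
    (n : ℝ) * (1 - 1 / (3 * s)) ^ (3 * s * (Nat.clog 2 n + 2)) < 1 / 3 := by
  have hsR : (1 : ℝ) ≤ s := by exact_mod_cast hs
  have h0 : 0 ≤ (1 : ℝ) - 1 / (3 * s) := by
    rw [sub_nonneg, div_le_one (by positivity)]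
    linarith
  have h1 : ((1 : ℝ) - 1 / (3 * s)) ^ (3 * s) ≤ 1 / 2 := by
    calc ((1 : ℝ) - 1 / (3 * s)) ^ (3 * s) ≤ Real.exp (-(1 / (3 * s))) ^ (3 * s) :=
          pow_le_pow_left₀ h0 (Real.one_sub_le_exp_neg _) _
      _ = Real.exp (-1) := by
          rw [← Real.exp_nat_mul]
          congr 1
          push_cast
          field_simp
      _ ≤ 1 / 2 := by
          rw [Real.exp_neg, one_div]
          exact inv_anti₀ (by norm_num) (by linarith [Real.add_one_le_exp 1])
  have h2 : (n : ℝ) ≤ 2 ^ Nat.clog 2 n := by exact_mod_cast Nat.le_pow_clog (by norm_num) n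
  rw [pow_mul]
  calc (n : ℝ) * (((1 : ℝ) - 1 / (3 * s)) ^ (3 * s)) ^ (Nat.clog 2 n + 2)
      ≤ 2 ^ Nat.clog 2 n * (1 / 2) ^ (Nat.clog 2 n + 2) := by
        gcongr
    _ = 1 / 4 := by
        rw [pow_add, ← mul_assoc, ← mul_pow]
        norm_num
    _ < 1 / 3 := by norm_num

theorem clog_add_two_le {n : ℕ} (hn : 2 ≤ n) : ((Nat.clog 2 n + 2 : ℕ) : ℝ) ≤ 6 * Real.log n := by
  have h2 : (0.69 : ℝ) ≤ Real.log 2 := by linarith [Real.log_two_gt_d9]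
  have hlog : Real.log 2 ≤ Real.log n := Real.log_le_log (by norm_num) (by exact_mod_cast hn)
  have h1 : Nat.clog 2 n ≠ 0 := (Nat.clog_pos (by norm_num) hn).ne'
  obtain ⟨m, hm⟩ := Nat.exists_eq_succ_of_ne_zero h1
  have hlt : 2 ^ m < n := by
    rw [← not_le]
    intro h
    have := (Nat.clog_le_iff_le_pow (b := 2) (by norm_num)).2 h
    omega
  have hmlog : m * Real.log 2 ≤ Real.log n := by
    rw [← Real.log_pow]
    exact Real.log_le_log (by positivity) (by exact_mod_cast hlt.le)
  rw [hm]
  push_cast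
  have : (m : ℝ) * 0.69 ≤ Real.log n := (by gcongr : (m : ℝ) * 0.69 ≤ m * Real.log 2).trans hmlog
  linarith

/-- The root is rounded up; since it is at least `1`, this at most doubles it. -/
theorem exists_root_bound {n k : ℕ} (hn : 1 ≤ n) (hk : 1 ≤ k) :
    ∃ s : ℕ, 0 < s ∧ n ≤ s ^ k ∧ (s : ℝ) ≤ 2 * (n : ℝ) ^ (1 / (k : ℝ)) := by
  have hnR : (1 : ℝ) ≤ n := by exact_mod_cast hn
  have h1 : (1 : ℝ) ≤ (n : ℝ) ^ (1 / (k : ℝ)) := Real.one_le_rpow hnR (by positivity)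
  refine ⟨⌈(n : ℝ) ^ (1 / (k : ℝ))⌉₊, Nat.ceil_pos.2 (by linarith), ?_, ?_⟩
  · have : (n : ℝ) = ((n : ℝ) ^ (1 / (k : ℝ))) ^ k := by
      rw [one_div, Real.rpow_inv_natCast_pow (by linarith) (by omega)]
    have h2 : (n : ℝ) ≤ (⌈(n : ℝ) ^ (1 / (k : ℝ))⌉₊ : ℝ) ^ k := by
      conv_lhs => rw [this]
      exact pow_le_pow_left₀ (by linarith) (Nat.le_ceil _) _
    exact_mod_cast h2
  · have := Nat.ceil_lt_add_one (show 0 ≤ (n : ℝ) ^ (1 / (k : ℝ)) by linarith)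
    linarith

theorem rpow_one_add_one_div {n k : ℕ} (hn : 1 ≤ n) :
    (n : ℝ) ^ (1 + 1 / (k : ℝ)) = n * (n : ℝ) ^ (1 / (k : ℝ)) := by
  rw [Real.rpow_add (by exact_mod_cast hn), Real.rpow_one]

theorem isSpanner_bot_of_le_one {n : ℕ} (hn : n ≤ 1) (l : ℕ) (G : SimpleGraph (Fin n))
    (w : Sym2 (Fin n) → ℕ) : IsSpanner l G w ⊥ := by
  have : Subsingleton (Fin n) := Fin.subsingleton_iff_le_one.2 hn
  refine ⟨bot_le, fun u v => ?_⟩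
  rw [Subsingleton.elim u v, wdist_self]
  exact zero_le

end Parameters

/-! ### Assembling both algorithms -/

section MainTheorem

theorem exists_spanner_of_phases {n k s q : ℕ} {V : Type} [LinearOrder V]
    {G : SimpleGraph (Fin n)} {w : Sym2 (Fin n) → ℕ} {ident : Fin n → V}
    (hid : ident.Injective) (hn : 1 ≤ n) (hk : 1 ≤ k) (hs : 0 < s) (hnk : n ≤ s ^ k)
    (hsn : (s : ℝ) ≤ 2 * (n : ℝ) ^ (1 / (k : ℝ)))
    (hsq : s < q) (hq : (n : ℝ) * (1 - 1 / (3 * s)) ^ q < 1 / 3) :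
    ((∀ t, (phases (renamedEdges G w ident) n s q t).2.ncard ≤ t * (9 * n * s)) ∧
      (∀ t ≤ k, (phases (renamedEdges G w ident) n s q t).2 ⊆ renamedEdges G w ident)) ∧
    ∃ H : SimpleGraph (Fin n), IsSpanner (2 * k - 1) G w H ∧
      (H.edgeSet.ncard : ℝ) ≤ 100 * (k * (n : ℝ) ^ (1 + 1 / (k : ℝ))) ∧
      (phases (renamedEdges G w ident) n s q k).2 = renamedEdges H w ident := by
  classical
  have hE := renamedEdges_finite G w ident
  have hEX : ∀ e ∈ renamedEdges G w ident, ∀ v ∈ e.1, v ∈ Finset.univ.image ident := by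
    rintro _ ⟨e, -, rfl⟩ v hv
    obtain ⟨u, -, rfl⟩ := Sym2.mem_map.1 hv
    exact Finset.mem_image_of_mem _ (Finset.mem_univ u)
  have hXn : (Finset.univ.image ident).card ≤ n := Finset.card_image_le.trans (by simp)
  have hR := exists_goodSample_candidates hE hEX hXn hn hs hsq hq
  obtain ⟨h1, h2⟩ := phases_spec hE hEX hXn hn hs hsq hq hk hnk
  refine ⟨⟨ncard_phases_le hR, fun t ht => (phaseInvariant_phases hE hR t ht).subset⟩, ?_⟩
  obtain ⟨H, hH, hcard, heq⟩ := exists_isSpanner hid (l := 2 * k - 1) (by omega) h1 h2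
  refine ⟨H, hH, ?_, heq⟩
  rw [rpow_one_add_one_div hn]
  have : (H.edgeSet.ncard : ℝ) ≤ k * (9 * n * s) := by
    exact_mod_cast hcard.trans (ncard_phases_le hR k)
  calc (H.edgeSet.ncard : ℝ) ≤ k * (9 * n * s) := this
    _ ≤ k * (9 * n * (2 * (n : ℝ) ^ (1 / (k : ℝ)))) := by gcongr
    _ = 18 * (k * (n * (n : ℝ) ^ (1 / (k : ℝ)))) := by ring
    _ ≤ _ := by gcongr; norm_num

theorem exists_clique_algorithm (c d n k : ℕ) (hk : 1 ≤ k) :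
    ∃ (A : BCCAlgorithm ((c + d + 2) * Nat.clog 2 n)) (T : ℕ),
      (T : ℝ) ≤ 100 * (k * (n : ℝ) ^ (1 / (k : ℝ)) * Real.log n) ∧
      ∀ (G : SimpleGraph (Fin n)) (w : Sym2 (Fin n) → ℕ) (ident : Fin n → ℕ),
        (∀ e ∈ G.edgeSet, w e ≤ n ^ c) → Function.Injective ident → (∀ v, ident v < n ^ d) →
        ∃ H : SimpleGraph (Fin n), IsSpanner (2 * k - 1) G w H ∧
          (H.edgeSet.ncard : ℝ) ≤ 100 * (k * (n : ℝ) ^ (1 + 1 / (k : ℝ))) ∧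
          ∀ v, A.output (A.run G w ident T v) = identEdges H w ident := by
  rcases Nat.lt_or_ge 1 n with hn | hn
  · obtain ⟨s, hs, hnk, hsn⟩ := exists_root_bound hn.le hk
    obtain ⟨q, hq⟩ : ∃ q, q = 3 * s * (Nat.clog 2 n + 2) := ⟨_, rfl⟩
    have hsq : s < q := by rw [hq]; nlinarith
    have hA := finite_ncard_le_of_injective (d := n ^ d)
      (A := {x : ℕ ×ₗ Fin (n ^ d) | (ofLex x).1 ≤ n ^ c}) ofLex ofLex.injective fun _ h => h
    let emb : ℕ ×ₗ Fin (n ^ d) → ℕ ×ₗ ℕ := fun x => toLex ((ofLex x).1, (ofLex x).2)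
    obtain ⟨dec, hnone, hdec⟩ := exists_decoder (hA.1.image emb)
      ((Nat.add_le_add_right ((ncard_image_le hA.1).trans hA.2) 1).trans (pow_bits_bound hn c d))
    refine ⟨cliqueAlgorithm dec n s q, k * q, ?_, fun G w ident hw hid hlt => ?_⟩
    · push_cast
      have hqR : (q : ℝ) ≤ 3 * (2 * (n : ℝ) ^ (1 / (k : ℝ))) * (6 * Real.log n) := by
        rw [hq, Nat.cast_mul (3 * s), Nat.cast_mul 3 s]
        exact mul_le_mul (by push_cast; gcongr) (clog_add_two_le hn) (by positivity) (by positivity)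
      have hlog : 0 ≤ Real.log n := Real.log_natCast_nonneg n
      calc (k * q : ℝ) ≤ k * (3 * (2 * (n : ℝ) ^ (1 / (k : ℝ))) * (6 * Real.log n)) := by gcongr
        _ = 36 * (k * (n : ℝ) ^ (1 / (k : ℝ)) * Real.log n) := by ring
        _ ≤ _ := by gcongr; norm_num
    · obtain ⟨-, H, hH, hcard, heq⟩ := exists_spanner_of_phases (G := G) (w := w) hid hn.le hk hs
        hnk hsn hsq (hq ▸ mul_one_sub_pow_lt hs)
      refine ⟨H, hH, hcard, fun v => ?_⟩
      rw [cliqueAlgorithm_output (by omega) hid hnone, heq]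
      · rfl
      · intro u a ha
        obtain ⟨v, hv, h2, h1⟩ := (mem_renamedEdges hid).1 ha
        refine hdec a ⟨toLex ((ofLex a).1, ⟨ident v, hlt v⟩), ?_, ?_⟩
        · exact h1 ▸ hw _ hv
        · exact ofLex.injective (Prod.ext rfl h2.symm)
  -- For `n ≤ 1` the logarithm vanishes, so no round is allowed; the graph has no edges anyway.
  · refine ⟨⟨Unit, fun _ => (), fun _ _ => false, fun _ _ => (), fun _ => ∅⟩, 0, ?_,
      fun G w ident _ _ _ => ⟨⊥, isSpanner_bot_of_le_one hn _ G w, ?_, fun v => ?_⟩⟩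
    · have : 0 ≤ Real.log n := Real.log_natCast_nonneg n
      rw [Nat.cast_zero]
      positivity
    · rw [SimpleGraph.edgeSet_bot, ncard_empty, Nat.cast_zero]
      positivity
    · simp [identEdges]

theorem exists_streaming_algorithm (c n k : ℕ) (hk : 1 ≤ k) :
    ∃ (S : ℕ) (A : StreamingAlgorithm n S ((c + 4) * Nat.clog 2 n)),
      (S : ℝ) ≤ 100 * ((k + Real.log n) * (n : ℝ) ^ (1 + 1 / (k : ℝ))) ∧
      ∀ (G : SimpleGraph (Fin n)) (w : Sym2 (Fin n) → ℕ) (stream : List (Sym2 (Fin n) × ℕ)),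
        (∀ e ∈ G.edgeSet, w e ≤ n ^ c) → IsEdgeStream G w stream →
        ∃ H : SimpleGraph (Fin n), IsSpanner (2 * k - 1) G w H ∧
          (H.edgeSet.ncard : ℝ) ≤ 100 * (k * (n : ℝ) ^ (1 + 1 / (k : ℝ))) ∧
          A.output (A.run stream k) = weightedEdges H w := by
  have hlog : 0 ≤ Real.log n := Real.log_natCast_nonneg n
  rcases Nat.lt_or_ge 1 n with hn | hn
  · obtain ⟨s, hs, hnk, hsn⟩ := exists_root_bound hn.le hk
    obtain ⟨q, hq⟩ : ∃ q, q = 3 * s * (Nat.clog 2 n + 2) := ⟨_, rfl⟩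
    have hsq : s < q := by rw [hq]; nlinarith
    obtain ⟨D, hD⟩ := exists_memory_decoder hn c (k * (9 * n * s)) q
    refine ⟨_, streamAlgorithm D s q, ?_, fun G w stream hw hst => ?_⟩
    · push_cast
      rw [rpow_one_add_one_div hn.le]
      have hqR : (q : ℝ) ≤ 3 * (2 * (n : ℝ) ^ (1 / (k : ℝ))) * (6 * Real.log n) := by
        rw [hq, Nat.cast_mul (3 * s), Nat.cast_mul 3 s]
        exact mul_le_mul (by push_cast; gcongr) (clog_add_two_le hn) (by positivity) (by positivity)
      have hkR : (1 : ℝ) ≤ k := by exact_mod_cast hk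
      have hroot : (1 : ℝ) ≤ (n : ℝ) ^ (1 / (k : ℝ)) :=
        Real.one_le_rpow (by exact_mod_cast hn.le) (by positivity)
      have h1 : (n : ℝ) ≤ k * (n * (n : ℝ) ^ (1 / (k : ℝ))) := by
        calc (n : ℝ) = 1 * (n * 1) := by ring
          _ ≤ _ := by gcongr
      -- The three terms count the words for the clustering, the spanner and the candidate lists.
      calc (n + (k * (9 * n * s) + n * q) : ℝ)
          ≤ k * (n * (n : ℝ) ^ (1 / (k : ℝ))) + (k * (9 * n * (2 * (n : ℝ) ^ (1 / (k : ℝ)))) +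
            n * (3 * (2 * (n : ℝ) ^ (1 / (k : ℝ))) * (6 * Real.log n))) := by gcongr
        _ = (19 * k + 36 * Real.log n) * (n * (n : ℝ) ^ (1 / (k : ℝ))) := by ring
        _ ≤ (100 * (k + Real.log n)) * (n * (n : ℝ) ^ (1 / (k : ℝ))) := by
          gcongr
          linarith
        _ = _ := by ring
    · have hren : ∀ H : SimpleGraph (Fin n), renamedEdges H w id = weightedEdges H w := fun H => by
        have hid (e : Sym2 (Fin n)) : e.map id = e := congrFun Sym2.map_id e
        simp only [renamedEdges, weightedEdges, hid]
      obtain ⟨⟨hcard, hsub⟩, H, hH, hHcard, heq⟩ := exists_spanner_of_phases (G := G) (w := w)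
        Function.injective_id hn.le hk hs hnk hsn hsq (hq ▸ mul_one_sub_pow_lt hs)
      rw [hren H] at heq
      rw [hren G] at hcard hsub heq
      refine ⟨H, hH, hHcard, ?_⟩
      rw [← heq]
      have hrun := streamAlgorithm_run hD (E := weightedEdges G w)
        (by rintro _ ⟨e, he, rfl⟩; exact hw e he) hcard hsub hst.2 k le_rfl
      exact congrArg (fun σ => σ.1.2) hrun
  · refine ⟨0, ⟨fun _ _ => false, fun m _ => m, id, fun _ => ∅⟩, ?_,
      fun G w stream _ _ => ⟨⊥, isSpanner_bot_of_le_one hn _ G w, ?_, ?_⟩⟩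
    · rw [Nat.cast_zero]
      positivity
    · rw [SimpleGraph.edgeSet_bot, ncard_empty, Nat.cast_zero]
      positivity
    · simp [weightedEdges]

end MainTheorem

end DistSpanner

theorem mainTheorem12 :
    -- broadcast congested clique
    (∃ C : ℝ, ∀ c d : ℕ, ∃ b : ℕ, ∀ n k : ℕ, 1 ≤ k →
      ∃ (A : DistSpanner.BCCAlgorithm (b * Nat.clog 2 n)) (T : ℕ),
        (T : ℝ) ≤ C * (k * (n : ℝ) ^ (1 / (k : ℝ)) * Real.log n) ∧
        ∀ (G : SimpleGraph (Fin n)) (w : Sym2 (Fin n) → ℕ) (ident : Fin n → ℕ),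
          (∀ e ∈ G.edgeSet, w e ≤ n ^ c) →
          Function.Injective ident → (∀ v, ident v < n ^ d) →
          ∃ H : SimpleGraph (Fin n),
            DistSpanner.IsSpanner (2 * k - 1) G w H ∧
            (H.edgeSet.ncard : ℝ) ≤ C * (k * (n : ℝ) ^ (1 + 1 / (k : ℝ))) ∧
            ∀ v, A.output (A.run G w ident T v) = DistSpanner.identEdges H w ident) ∧
    -- multipass streaming
    (∃ C : ℝ, ∀ c : ℕ, ∃ b : ℕ, ∀ n k : ℕ, 1 ≤ k →
      ∃ (S : ℕ) (A : DistSpanner.StreamingAlgorithm n S (b * Nat.clog 2 n)),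
        (S : ℝ) ≤ C * ((k + Real.log n) * (n : ℝ) ^ (1 + 1 / (k : ℝ))) ∧
        ∀ (G : SimpleGraph (Fin n)) (w : Sym2 (Fin n) → ℕ) (stream : List (Sym2 (Fin n) × ℕ)),
          (∀ e ∈ G.edgeSet, w e ≤ n ^ c) →
          DistSpanner.IsEdgeStream G w stream →
          ∃ H : SimpleGraph (Fin n),
            DistSpanner.IsSpanner (2 * k - 1) G w H ∧
            (H.edgeSet.ncard : ℝ) ≤ C * (k * (n : ℝ) ^ (1 + 1 / (k : ℝ))) ∧
            A.output (A.run stream k) = DistSpanner.weightedEdges H w) := by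
  exact ⟨⟨100, fun c d => ⟨c + d + 2, DistSpanner.exists_clique_algorithm c d⟩⟩,
    ⟨100, fun c => ⟨c + 4, DistSpanner.exists_streaming_algorithm c⟩⟩⟩
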